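/- **The game.** Let $x\in\mathbb R$ and $y>0$. Players A and B play with an $(x,y)$-cube and stake $1$. The game state is a standard Brownian motion started at some $p_0\in[0,1]$ and frozen as soon as it reaches $0$ or $1$; state $1$ is a win of A, state $0$ a win of B. A player's *evaluation* at a given state is the probability that the walk from this state ends in this player's win. At any time, also after the walk has been frozen, a player who has the right to double may offer a double. If the opponent accepts, the stake is multiplied by $y$ and the right to double passes to the opponent alone; if the opponent declines, the game ends and the opponent pays the doubler $x$ times the current stake. If no further double is offered, the loser of the walk pays the current stake to the winner. A *position* consists of the starting state $p_0\in[0,1]$, the number $k\in\mathbb N$ of doubles still available, and the information whether both players or only one given player may offer the next double; if both players offer at the same time, the offer of one player, fixed in advance, counts. Players may use arbitrary non-anticipating strategies (the time of the next offer is a stopping time, and acceptance depends only on the past), and maximize their expected payoff. For a closed set $D\subseteq[0,1]$, *doubling at the evaluations in $D$* means offering a double, whenever one has the right to, at the first time when one's own evaluation is in $D$ ($D=\varnothing$: never). It is called *optimal* if, together with a suitable (measurable) rule for accepting or declining that depends only on one's own evaluation, the number of doubles available and whether both players had the right to double, its use by both players is an equilibrium from every position and for either tie-breaking convention: no player can increase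 the own expected payoff by switching to another strategy. It is called *uniquely optimal* if moreover no other closed set $D'\subseteq[0,1]$ is optimal. **Theorem 3.1.** Let $x\in\mathbb R$ and $y>0$. 1. If $x\ge y$ and $y>1$, then doubling at evaluation $p=1$ is uniquely optimal. 2. If $x\ge 0$ and $y\le 1$, then doubling at evaluation $p=0$ is optimal, and uniquely so if $y<1$. 3. If $x<0$ and ($-x>1$ or $y>1$), then never doubling is uniquely optimal. 4. If $-1\le x\le 0$ and $y\le -x$, then doubling at evaluation $p=0$ is optimal, and uniquely so if $x>-1$. -/

import Mathlib

open MeasureTheory ProbabilityTheory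
open scoped NNReal

noncomputable section

namespace DoublingGame

/-- `B` is a standard Brownian motion relative to the filtration `𝓕` (started at `0`, with every
path continuous): it is adapted, and its increments after time `s` are independent of `𝓕 s`. -/
structure IsBrownianMotion {Ω : Type*} {mΩ : MeasurableSpace Ω} (𝓕 : Filtration ℝ≥0 mΩ)
    (B : ℝ≥0 → Ω → ℝ) (P : Measure Ω) : Prop where
  brownian : IsBrownianReal B P
  zero : ∀ ω, B 0 ω = 0
  continuous_path : ∀ ω, Continuous fun t => B t ω
  adapted : ∀ t, Measurable[𝓕 t] (B t)
  indep : ∀ s t, s ≤ t →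
    Indep (MeasurableSpace.comap (fun ω => B t ω - B s ω) inferInstance) (𝓕 s) P

/-- The two players. -/
inductive Player
  | A
  | B
  deriving DecidableEq

/-- The opponent. -/
def Player.opp : Player → Player
  | .A => .B
  | .B => .A

/-- The sign with which a player's gain enters Player A's payoff (the game is zero-sum). -/
def Player.sign : Player → ℝ
  | .A => 1
  | .B => -1

section State

variable {Ω : Type*}

/-- The game state (Player A's side): Brownian motion started at `p`, stopped (frozen forever) as
soon as it leaves the open interval `(0, 1)`. State `1` is a win of Player A, state `0` a loss. -/
def state (B : ℝ≥0 → Ω → ℝ) (p : ℝ) : ℝ≥0 → Ω → ℝ :=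
  stoppedProcess (fun t ω => p + B t ω) (hittingAfter (fun t ω => p + B t ω) (Set.Ioo 0 1)ᶜ 0)

/-- The evaluation of a player when the game state is `q`: the probability that the walk from `q`
reaches `1` before `0` (for Player A), or `0` before `1` (for Player B). The walk `state B q` is
frozen at whichever of the two it reaches first. -/
def evaluation [MeasurableSpace Ω] (P : Measure Ω) (B : ℝ≥0 → Ω → ℝ) : Player → ℝ → ℝ
  | .A, q => P.real {ω | ∃ t, state B q t ω = 1}
  | .B, q => P.real {ω | ∃ t, state B q t ω = 0}

open scoped Classical in
/-- Player A's payoff, per unit of the stake, if no further double is offered: `1` if the walk ends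
in `1`, and `-1` if it ends in `0`. -/
def outcome (B : ℝ≥0 → Ω → ℝ) (p : ℝ) (ω : Ω) : ℝ :=
  if ∃ t, state B p t ω = 1 then 1 else if ∃ t, state B p t ω = 0 then -1 else 0

end State

/-- A (general, path-dependent) strategy of one player. A stage of the game is described by the
number `k` of doubles still available and by the position `h` of the cube: `h = none` if both
players may double, `h = some i` if only player `i` may.
* `propose k h t ω` is the time at which the player intends to double in the stage `(k, h)` if this
  stage has begun at time `t` (`⊤`: never in this stage);
* `accept k h t` is the event that the player accepts a double that the opponent offers at time `t`
  in the stage `(k, h)`; otherwise the player folds. -/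
structure Strategy (Ω : Type*) where
  propose : ℕ → Option Player → ℝ≥0 → Ω → WithTop ℝ≥0
  accept : ℕ → Option Player → ℝ≥0 → Set Ω

/-- Strategies that do not look into the future: if a stage begins at a stopping time, then the
intended time of doubling is a later (or the same) stopping time, and the decision about a double
offered at a stopping time `ρ` depends only on what is known at time `ρ`. -/
structure Strategy.Admissible {Ω : Type*} {mΩ : MeasurableSpace Ω} (𝓕 : Filtration ℝ≥0 mΩ)
    (σ : Strategy Ω) : Prop where
  le_propose : ∀ k h (t : ℝ≥0) ω, (t : WithTop ℝ≥0) ≤ σ.propose k h t ω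
  propose_stopping : ∀ k h (ρ : Ω → WithTop ℝ≥0), IsStoppingTime 𝓕 ρ →
    IsStoppingTime 𝓕 fun ω => WithTop.recTopCoe (C := fun _ => WithTop ℝ≥0) ⊤
      (fun t : ℝ≥0 => σ.propose k h t ω) (ρ ω)
  accept_measurable : ∀ k h (ρ : Ω → WithTop ℝ≥0) (hρ : IsStoppingTime 𝓕 ρ),
    MeasurableSet[hρ.measurableSpace] {ω | ∃ t : ℝ≥0, ρ ω = t ∧ ω ∈ σ.accept k h t}

section Play

variable {Ω : Type*}

open scoped Classical in
/-- The player who doubles first (if at all) in the stage `(k, h)` that has begun at time `t`.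
If both may double and intend to do so simultaneously, the double of the player `first` counts. -/
def proposer (first : Player) (σ : Player → Strategy Ω) (k : ℕ) (h : Option Player)
    (t : ℝ≥0) (ω : Ω) : Player :=
  match h with
  | some i => i
  | none =>
    if (σ first).propose k none t ω ≤ (σ first.opp).propose k none t ω then first else first.opp

open scoped Classical in
/-- Player A's realized payoff in the game with the `(x, y)`-cube, from the beginning at time `t` of
the stage `(k, h)`, with unit stake. When a double is offered and accepted, the stake is multiplied
by `y` and the right to double passes to the opponent of the doubler; when it is declined, the game
ends and the doubler receives `x` times the stake from the opponent. If nobody doubles any more, the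
walk decides. -/
def payoff (x y : ℝ) (B : ℝ≥0 → Ω → ℝ) (p : ℝ) (first : Player) (σ : Player → Strategy Ω) :
    ℕ → Option Player → ℝ≥0 → Ω → ℝ
  | 0, _, _, ω => outcome B p ω
  | k + 1, h, t, ω =>
    let i := proposer first σ (k + 1) h t ω
    WithTop.recTopCoe (C := fun _ => ℝ) (outcome B p ω)
      (fun u : ℝ≥0 =>
        if ω ∈ (σ i.opp).accept (k + 1) h u then
          y * payoff x y B p first σ k (some i.opp) u ω
        else i.sign * x)
      ((σ i).propose (k + 1) h t ω)

/-- The expected payoff of player `i` in the game that starts at time `0` in state `p`, with `k`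
doubles available, cube position `h` and unit stake. -/
def expectedPayoff [MeasurableSpace Ω] (P : Measure Ω) (x y : ℝ) (B : ℝ≥0 → Ω → ℝ) (p : ℝ)
    (first : Player) (k : ℕ) (h : Option Player) (i : Player) (σ : Player → Strategy Ω) : ℝ :=
  ∫ ω, i.sign * payoff x y B p first σ k h 0 ω ∂P

/-- The strategy of a player who doubles, whenever this is allowed, as soon as the own evaluation
lies in `D` (in particular never, if `D` is empty), and who accepts a double if and only if the own
evaluation lies in `R k c`, where `k` is the number of doubles available before the offer and `c`
tells whether both players had the right to double. -/
def doublingRule [MeasurableSpace Ω] (P : Measure Ω) (B : ℝ≥0 → Ω → ℝ) (p : ℝ)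
    (D : Set ℝ) (R : ℕ → Bool → Set ℝ) (i : Player) : Strategy Ω where
  propose _ _ t := hittingAfter (fun u ω => evaluation P B i (state B p u ω)) D t
  accept k h t := {ω | evaluation P B i (state B p t ω) ∈ R k h.isNone}

/-- Doubling exactly at the evaluations in `D` is optimal in the game with the `(x, y)`-cube:
with a suitable rule for responding to doubles, it is the strategy of both players in an equilibrium
of the game. That is, from every starting state, with every number of doubles available, every
position of the cube and either way of breaking ties, no player can increase the own expected payoff
by switching to any other admissible strategy. As the game is zero-sum, this says that the strategy
attains the value of the game in all these positions. -/
def IsOptimalDoubling {Ω : Type*} {mΩ : MeasurableSpace Ω} (P : Measure Ω)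
    (𝓕 : Filtration ℝ≥0 mΩ) (B : ℝ≥0 → Ω → ℝ) (x y : ℝ) (D : Set ℝ) : Prop :=
  ∃ R : ℕ → Bool → Set ℝ, (∀ k c, MeasurableSet (R k c)) ∧
    ∀ p ∈ Set.Icc (0 : ℝ) 1, (∀ i, (doublingRule P B p D R i).Admissible 𝓕) ∧
      ∀ (first : Player) (k : ℕ) (h : Option Player) (i : Player) (τ : Strategy Ω),
        τ.Admissible 𝓕 →
        expectedPayoff P x y B p first k h i (Function.update (doublingRule P B p D R) i τ) ≤
          expectedPayoff P x y B p first k h i (doublingRule P B p D R)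

/-- Among the closed sets of evaluations, `D` is the only one at which doubling is optimal. -/
def OnlyOptimalDoubling {Ω : Type*} {mΩ : MeasurableSpace Ω} (P : Measure Ω)
    (𝓕 : Filtration ℝ≥0 mΩ) (B : ℝ≥0 → Ω → ℝ) (x y : ℝ) (D : Set ℝ) : Prop :=
  ∀ D' : Set ℝ, IsClosed D' → D' ⊆ Set.Icc 0 1 → IsOptimalDoubling P 𝓕 B x y D' → D' = D

end Play

end DoublingGame

end

noncomputable section

namespace DoublingGame

open Filter Topology

/-! The state is a bounded martingale that freezes almost surely, so a player's evaluation is simply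
the state seen from that player's side, and every affine function of the state can be carried from a
stopping time to the end of the walk by optional stopping. It therefore suffices to prescribe, for
each stage `(k, h)`, two numbers: what a won and what a lost walk is worth. The candidate value is
their affine interpolation in the own evaluation.

Such a candidate is a lower bound for a player's payoff, whatever the opponent does, once some
inequalities hold at single states: at the player's own offers in `D`, at the opponent's offers
answered by `R`, and for walks that end without a further double. These are the fields of
`Guarantees`. Induction on the number of doubles, splitting a stage by the way it ends, turns them
into an inequality of expectations (`Guarantees.setIntegral_le`). If the guarantees of the two
players sum to zero, neither can gain by deviating (`isOptimalDoubling_of_guarantees`). The four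
cases differ only in two factors `u` and `w`: a right of the eventual winner to double multiplies
the stake by `u`, such a right of the eventual loser multiplies it by `w`.

For uniqueness, every equilibrium of a zero-sum game pays each player the guaranteed value. The test
position has one double left, owned by Player A, against an opponent who always accepts or always
declines. There an immediate double at `q` is worth `y * (2 * q - 1)` or `x`, while failing to
double a decided walk is worth `1` or `-1`. Comparison with the value excludes all other sets
(`Guarantees.constraints`). -/

/-! ### Optional stopping for continuous martingales. -/

/-- The upper approximation of `r` on the grid of mesh `1 / (n + 1)`. -/
def gridCeil (n : ℕ) (r : ℝ≥0) : ℝ≥0 := ((⌊(n + 1) * r⌋₊ : ℝ≥0) + 1) / (n + 1)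

lemma lt_gridCeil (n : ℕ) (r : ℝ≥0) : r < gridCeil n r := by
  rw [gridCeil, lt_div_iff₀ (by positivity), mul_comm]
  exact Nat.lt_floor_add_one _

lemma gridCeil_le (n : ℕ) (r : ℝ≥0) : gridCeil n r ≤ r + 1 / (n + 1) := by
  rw [gridCeil, div_le_iff₀ (by positivity), add_mul r, div_mul_cancel₀ _ (by positivity),
    mul_comm r]
  gcongr
  exact Nat.floor_le (by positivity)

lemma tendsto_gridCeil (r : ℝ≥0) : Tendsto (fun n => gridCeil n r) atTop (𝓝 r) := by
  refine tendsto_of_tendsto_of_tendsto_of_le_of_le tendsto_const_nhds ?_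
    (fun n => (lt_gridCeil n r).le) (fun n => gridCeil_le n r)
  have : Tendsto (fun n : ℕ => (1 : ℝ≥0) / (n + 1)) atTop (𝓝 0) :=
    tendsto_one_div_add_atTop_nhds_zero_nat (𝕜 := ℝ≥0)
  simpa using this.const_add r

lemma gridCeil_le_iff (n : ℕ) (r t : ℝ≥0) :
    gridCeil n r ≤ t ↔ r < (⌊(n + 1) * t⌋₊ : ℝ≥0) / (n + 1) := by
  rw [gridCeil, div_le_iff₀ (by positivity), lt_div_iff₀ (by positivity), mul_comm t, mul_comm r,
    ← Nat.floor_lt (by positivity), ← Nat.succ_le_iff, Nat.le_floor_iff (by positivity)]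
  push_cast
  rfl

lemma floor_div_le (n : ℕ) (t : ℝ≥0) : (⌊(n + 1) * t⌋₊ : ℝ≥0) / (n + 1) ≤ t := by
  rw [div_le_iff₀ (by positivity), mul_comm t]
  exact Nat.floor_le (by positivity)

variable {Ω : Type*} {mΩ : MeasurableSpace Ω} {P : Measure Ω} {𝓕 : Filtration ℝ≥0 mΩ}
  {B : ℝ≥0 → Ω → ℝ}

/-- Because `gridCeil` lies strictly above its argument, it is at most `t` exactly if `S` is
strictly below the last grid point before `t`, an event already known at that grid point. -/
lemma isStoppingTime_gridCeil {S : Ω → ℝ≥0} (hS : IsStoppingTime 𝓕 fun ω => (S ω : WithTop ℝ≥0))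
    (n : ℕ) : IsStoppingTime 𝓕 fun ω => (gridCeil n (S ω) : WithTop ℝ≥0) := by
  intro t
  have h := hS.measurableSet_lt_le (floor_div_le n t)
  convert h using 3 with ω
  rw [WithTop.coe_le_coe, WithTop.coe_lt_coe, gridCeil_le_iff]

lemma countable_range_gridCeil (n : ℕ) : (Set.range (gridCeil n)).Countable := by
  refine (Set.countable_range fun k : ℕ => ((k : ℝ≥0) + 1) / (n + 1)).mono ?_
  rintro _ ⟨r, rfl⟩
  exact ⟨⌊(n + 1) * r⌋₊, rfl⟩

/-- Optional stopping for a continuous martingale at a bounded stopping time. -/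
theorem integral_continuous_martingale_eq [IsProbabilityMeasure P] {M : ℝ≥0 → Ω → ℝ}
    (hM : Martingale M 𝓕 P) (hc : ∀ ω, Continuous fun t => M t ω) {S : Ω → ℝ≥0}
    (hS : IsStoppingTime 𝓕 fun ω => (S ω : WithTop ℝ≥0)) {N : ℝ≥0} (hN : ∀ ω, S ω ≤ N)
    (hint : Integrable (fun ω => M (S ω) ω) P) :
    ∫ ω, M (S ω) ω ∂P = ∫ ω, M N ω ∂P := by
  -- The times `T n` approximate `S` from above and have countable range, so discrete optional
  -- stopping represents `M` at `T n` as a conditional expectation of `M N`.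
  set T : ℕ → Ω → ℝ≥0 := fun n ω => min (gridCeil n (S ω)) N with hT
  have hTs : ∀ n, IsStoppingTime 𝓕 fun ω => (T n ω : WithTop ℝ≥0) := fun n =>
    (isStoppingTime_gridCeil hS n).min_const N
  have hTN : ∀ n ω, (T n ω : WithTop ℝ≥0) ≤ (N : WithTop ℝ≥0) := fun n ω =>
    WithTop.coe_le_coe.2 (min_le_right _ _)
  have hcr : ∀ n, (Set.range fun ω => (T n ω : WithTop ℝ≥0)).Countable := by
    intro n
    refine ((countable_range_gridCeil n).image
      fun r => ((min r N : ℝ≥0) : WithTop ℝ≥0)).mono ?_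
    rintro _ ⟨ω, rfl⟩
    exact ⟨_, ⟨S ω, rfl⟩, rfl⟩
  have hce : ∀ n, (fun ω => M (T n ω) ω) =ᵐ[P] P[M N | (hTs n).measurableSpace] := fun n =>
    hM.stoppedValue_ae_eq_condExp_of_le_const_of_countable_range (hTs n) (hTN n) (hcr n)
  -- Conditional expectations of one integrable variable are uniformly integrable; with the
  -- pointwise convergence from path continuity, Vitali's theorem gives convergence in L¹.
  have hui : UniformIntegrable (fun n ω => M (T n ω) ω) 1 P :=
    ((hM.integrable N).uniformIntegrable_condExp
      fun n => (hTs n).measurableSpace_le).ae_eq fun n => (hce n).symm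
  have hlim : ∀ ω, Tendsto (fun n => M (T n ω) ω) atTop (𝓝 (M (S ω) ω)) := by
    intro ω
    refine (hc ω).continuousAt.tendsto.comp ?_
    have := (tendsto_gridCeil (S ω)).min (tendsto_const_nhds (x := N))
    rwa [min_eq_left (hN ω)] at this
  have hL := tendsto_Lp_finite_of_tendsto_ae le_rfl ENNReal.one_ne_top hui.1
    (memLp_one_iff_integrable.2 hint) hui.2.1 (ae_of_all _ hlim)
  have hI := tendsto_integral_of_L1' _ hint.1 (Eventually.of_forall fun n =>
    memLp_one_iff_integrable.1 (hui.memLp n)) hL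
  refine tendsto_nhds_unique hI ?_
  have : ∀ n, ∫ ω, M (T n ω) ω ∂P = ∫ ω, M N ω ∂P := fun n => by
    rw [integral_congr_ae (hce n), integral_condExp (hTs n).measurableSpace_le]
  simp only [this]
  exact tendsto_const_nhds

/-- Brownian motion is a martingale. -/
lemma IsBrownianMotion.martingale [IsProbabilityMeasure P] {B : ℝ≥0 → Ω → ℝ}
    (hB : IsBrownianMotion 𝓕 B P) : Martingale B 𝓕 P := by
  refine ⟨fun t => (hB.adapted t).stronglyMeasurable, fun s t hst => ?_⟩
  have hi : ∀ t, Integrable (B t) P := fun t => hB.brownian.integrable_eval t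
  have hm : ∀ t, Measurable (B t) := fun t => (hB.adapted t).mono (𝓕.le t) le_rfl
  have h := condExp_indep_eq (f := fun ω => B t ω - B s ω) (((hm t).sub (hm s)).comap_le)
    (𝓕.le s) (comap_measurable _).stronglyMeasurable (hB.indep s t hst)
  have h0 : ∫ ω, (B t ω - B s ω) ∂P = 0 := by
    rw [integral_sub (hi t) (hi s), hB.brownian.integral_eval, hB.brownian.integral_eval, sub_zero]
  have h1 := condExp_sub (hi t) (hi s) (𝓕 s)
  have h2 : P[B s | 𝓕 s] = B s :=
    condExp_of_stronglyMeasurable (𝓕.le s) (hB.adapted s).stronglyMeasurable (hi s)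
  filter_upwards [h, h1] with ω h h1
  have h3 : P[B t - B s | 𝓕 s] ω = 0 := by rw [← h0]; exact h
  rw [h1, Pi.sub_apply, h2] at h3
  linarith

/-- Optional stopping for a continuous martingale between two stopping times that are bounded
where they are finite, on the event that they are finite. -/
theorem setIntegral_continuous_martingale_eq [IsProbabilityMeasure P] {M : ℝ≥0 → Ω → ℝ}
    (hM : Martingale M 𝓕 P) (hc : ∀ ω, Continuous fun t => M t ω) {S : Ω → WithTop ℝ≥0}
    (hS : IsStoppingTime 𝓕 S) {N : ℝ≥0} (hN : ∀ ω, S ω ≠ ⊤ → S ω ≤ N)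
    {C : ℝ} (hC : ∀ ω, S ω ≠ ⊤ → |M (S ω).untopA ω| ≤ C) :
    ∫ ω in {ω | S ω ≠ ⊤}, M (S ω).untopA ω ∂P = ∫ ω in {ω | S ω ≠ ⊤}, M N ω ∂P := by
  have hprog : IsStronglyProgressive 𝓕 M :=
    hM.stronglyAdapted.isStronglyProgressive_of_continuous hc
  have hmeas : MeasurableSet {ω | S ω ≠ ⊤} := hS.measurableSet_eq_top.compl
  have hmeas' : {ω | S ω ≠ ⊤}ᶜ = {ω | S ω = ⊤} := by ext; simp
  have hSm : Measurable (stoppedValue M S) :=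
    (measurable_stoppedValue hprog hS).mono hS.measurableSpace_le le_rfl
  have hfin : ∀ ω, ((min (S ω) N).untopA : WithTop ℝ≥0) = min (S ω) N := fun ω => by
    have : min (S ω) N ≠ ⊤ := ne_top_of_le_ne_top WithTop.coe_ne_top (min_le_right _ _)
    obtain ⟨r, hr⟩ := WithTop.ne_top_iff_exists.1 this
    rw [← hr]; rfl
  have hst : IsStoppingTime 𝓕 fun ω => ((min (S ω) N).untopA : WithTop ℝ≥0) := by
    simp only [hfin]
    exact hS.min_const N
  have heq1 : ∀ ω, S ω ≠ ⊤ → (min (S ω) N).untopA = (S ω).untopA := fun ω h => by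
    rw [min_eq_left (hN ω h)]
  have heq2 : ∀ ω, S ω = ⊤ → (min (S ω) N).untopA = N := fun ω h => by
    rw [h, min_eq_right le_top]; rfl
  have hi1 : IntegrableOn (fun ω => M (S ω).untopA ω) {ω | S ω ≠ ⊤} P :=
    Measure.integrableOn_of_bounded (M := C) (measure_ne_top _ _) hSm.aestronglyMeasurable
      ((ae_restrict_iff' hmeas).2 (ae_of_all _ fun ω h => hC ω h))
  have hi2 : IntegrableOn (fun ω => M (min (S ω) N).untopA ω) {ω | S ω ≠ ⊤} P :=
    hi1.congr_fun (fun ω h => by simp only [heq1 ω h]) hmeas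
  have hi3 : IntegrableOn (fun ω => M (min (S ω) N).untopA ω) {ω | S ω ≠ ⊤}ᶜ P :=
    (hM.integrable N).integrableOn.congr_fun
      (fun ω h => by rw [hmeas'] at h; simp only [heq2 ω h]) hmeas.compl
  have hi : Integrable (fun ω => M (min (S ω) N).untopA ω) P := by
    rw [← integrableOn_univ, ← Set.union_compl_self {ω | S ω ≠ ⊤}]
    exact hi2.union hi3
  -- The bounded stopping time `min S N` is `S` where `S` is finite and `N` elsewhere, so the
  -- contributions of the complement cancel.
  have key := integral_continuous_martingale_eq hM hc (N := N) hst (fun ω => by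
    rw [← WithTop.coe_le_coe, hfin]; exact min_le_right _ _) hi
  rw [← integral_add_compl hmeas hi, ← integral_add_compl hmeas (hM.integrable N)] at key
  have e1 : ∫ ω in {ω | S ω ≠ ⊤}, M (min (S ω) N).untopA ω ∂P
      = ∫ ω in {ω | S ω ≠ ⊤}, M (S ω).untopA ω ∂P :=
    setIntegral_congr_fun hmeas fun ω h => by simp only [heq1 ω h]
  have e2 : ∫ ω in {ω | S ω ≠ ⊤}ᶜ, M (min (S ω) N).untopA ω ∂P
      = ∫ ω in {ω | S ω ≠ ⊤}ᶜ, M N ω ∂P :=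
    setIntegral_congr_fun hmeas.compl fun ω h => by rw [hmeas'] at h; simp only [heq2 ω h]
  linarith

/-! ### The frozen walk: paths, measurability, and freezing in finite time. -/

/-- The time at which the walk from `p` is frozen. -/
def exitTime (B : ℝ≥0 → Ω → ℝ) (p : ℝ) : Ω → WithTop ℝ≥0 :=
  hittingAfter (fun t ω => p + B t ω) (Set.Ioo 0 1)ᶜ 0

lemma exitTime_eq_top_or (hB : IsBrownianMotion 𝓕 B P) {p : ℝ} (hp : p ∈ Set.Icc (0 : ℝ) 1)
    (ω : Ω) :
    (exitTime B p ω = ⊤ ∧ ∀ t, p + B t ω ∈ Set.Ioo (0 : ℝ) 1) ∨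
    ∃ u : ℝ≥0, exitTime B p ω = u ∧ (∀ t < u, p + B t ω ∈ Set.Ioo (0 : ℝ) 1) ∧
      (p + B u ω = 0 ∨ p + B u ω = 1) := by
  have hf : Continuous fun t => p + B t ω := continuous_const.add (hB.continuous_path ω)
  by_cases h : ∃ j : ℝ≥0, 0 ≤ j ∧ p + B j ω ∈ (Set.Ioo (0 : ℝ) 1)ᶜ
  · right
    set E : Set ℝ≥0 := {i | 0 ≤ i ∧ p + B i ω ∈ (Set.Ioo (0 : ℝ) 1)ᶜ} with hE
    have hEc : IsClosed E := (isClosed_le continuous_const continuous_id).inter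
      (isOpen_Ioo.isClosed_compl.preimage hf)
    have hmem : sInf E ∈ E := hEc.csInf_mem h (OrderBot.bddBelow E)
    have hlt : ∀ t < sInf E, p + B t ω ∈ Set.Ioo (0 : ℝ) 1 := fun t ht => by
      by_contra hn
      exact notMem_of_lt_csInf ht (OrderBot.bddBelow E) ⟨zero_le, hn⟩
    refine ⟨sInf E, ?_, hlt, ?_⟩
    · rw [exitTime, hittingAfter_def]
      exact if_pos h
    · have hIcc : p + B (sInf E) ω ∈ Set.Icc (0 : ℝ) 1 := by
        -- At time `0` the walk is at `p`. At a later exit time its position is a limit of earlier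
        -- positions in the open interval.
        rcases eq_or_ne (sInf E) 0 with h0 | h0
        · rw [h0, hB.zero, add_zero]
          exact hp
        · have hcl : sInf E ∈ closure (Set.Iio (sInf E)) := by
            rw [closure_Iio' ⟨0, pos_iff_ne_zero.2 h0⟩]
            exact Set.self_mem_Iic
          have := map_mem_closure hf hcl hlt
          rwa [closure_Ioo zero_ne_one] at this
      have hn := hmem.2
      rcases hIcc.1.eq_or_lt with h0 | h0
      · exact Or.inl h0.symm
      · rcases hIcc.2.eq_or_lt with h1 | h1
        · exact Or.inr h1
        · exact absurd ⟨h0, h1⟩ hn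
  · left
    refine ⟨by rw [exitTime, hittingAfter_def]; exact if_neg h, fun t => ?_⟩
    by_contra hn
    exact h ⟨t, zero_le, hn⟩

lemma state_of_le {p : ℝ} {t : ℝ≥0} {ω : Ω} (h : (t : WithTop ℝ≥0) ≤ exitTime B p ω) :
    state B p t ω = p + B t ω :=
  stoppedProcess_eq_of_le h

lemma state_of_ge {p : ℝ} {t u : ℝ≥0} {ω : Ω} (h : exitTime B p ω = u) (hut : u ≤ t) :
    state B p t ω = p + B u ω := by
  have : exitTime B p ω ≤ t := by rw [h]; exact WithTop.coe_le_coe.2 hut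
  refine (stoppedProcess_eq_of_ge this).trans ?_
  rw [h]
  rfl

lemma state_cases (hB : IsBrownianMotion 𝓕 B P) {p : ℝ} (hp : p ∈ Set.Icc (0 : ℝ) 1) (ω : Ω) :
    (exitTime B p ω = ⊤ ∧ ∀ t, state B p t ω ∈ Set.Ioo (0 : ℝ) 1) ∨
    ∃ u : ℝ≥0, exitTime B p ω = u ∧ (∀ t < u, state B p t ω ∈ Set.Ioo (0 : ℝ) 1) ∧
      ((∀ t ≥ u, state B p t ω = 0) ∨ ∀ t ≥ u, state B p t ω = 1) := by
  rcases exitTime_eq_top_or hB hp ω with ⟨h, h'⟩ | ⟨u, h, hlt, hu⟩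
  · exact Or.inl ⟨h, fun t => by rw [state_of_le (h ▸ le_top)]; exact h' t⟩
  · refine Or.inr ⟨u, h, fun t ht => ?_, ?_⟩
    · rw [state_of_le (h ▸ WithTop.coe_le_coe.2 ht.le)]
      exact hlt t ht
    · exact hu.imp (fun hu t ht => (state_of_ge h ht).trans hu)
        fun hu t ht => (state_of_ge h ht).trans hu

lemma state_mem_Icc (hB : IsBrownianMotion 𝓕 B P) {p : ℝ} (hp : p ∈ Set.Icc (0 : ℝ) 1) (t : ℝ≥0)
    (ω : Ω) : state B p t ω ∈ Set.Icc (0 : ℝ) 1 := by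
  rcases state_cases hB hp ω with ⟨-, h⟩ | ⟨u, -, hlt, hu⟩
  · exact Set.Ioo_subset_Icc_self (h t)
  · rcases lt_or_ge t u with ht | ht
    · exact Set.Ioo_subset_Icc_self (hlt t ht)
    · rcases hu with hu | hu <;> simp [hu t ht]

lemma state_zero (hB : IsBrownianMotion 𝓕 B P) (p : ℝ) (ω : Ω) : state B p 0 ω = p := by
  rw [state_of_le (by simp), hB.zero, add_zero]

/-- The states `0` and `1` are absorbing. -/
lemma state_absorbing (hB : IsBrownianMotion 𝓕 B P) {p : ℝ} (hp : p ∈ Set.Icc (0 : ℝ) 1)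
    {b : ℝ} (hb : b = 0 ∨ b = 1) {s t : ℝ≥0} (hst : s ≤ t) {ω : Ω} (h : state B p s ω = b) :
    state B p t ω = b := by
  have hn : state B p s ω ∉ Set.Ioo (0 : ℝ) 1 := by rcases hb with rfl | rfl <;> simp [h]
  rcases state_cases hB hp ω with ⟨-, h'⟩ | ⟨u, -, hlt, hu⟩
  · exact absurd (h' s) hn
  · have hus : u ≤ s := not_lt.1 fun hsu => hn (hlt s hsu)
    rcases hu with hu | hu <;> rw [hu t (hus.trans hst), ← hu s hus, h]

lemma continuous_state (hB : IsBrownianMotion 𝓕 B P) {p : ℝ} (hp : p ∈ Set.Icc (0 : ℝ) 1)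
    (ω : Ω) : Continuous fun t => state B p t ω := by
  have hf : Continuous fun t => p + B t ω := continuous_const.add (hB.continuous_path ω)
  rcases exitTime_eq_top_or hB hp ω with ⟨h, -⟩ | ⟨u, h, -⟩
  · convert hf with t
    exact state_of_le (h ▸ le_top)
  · have : (fun t => state B p t ω) = fun t => p + B (min t u) ω := by
      funext t
      rcases le_total t u with ht | ht
      · rw [min_eq_left ht, state_of_le (h ▸ WithTop.coe_le_coe.2 ht)]
      · rw [min_eq_right ht, state_of_ge h ht]
    rw [this]
    exact hf.comp (continuous_id.min continuous_const)

/-- A continuous path leaves the open interval by time `t` if and only if on `[0, t]` it comes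
arbitrarily close to its ends or beyond them; by continuity it is enough to test a countable dense
set of times. Compactness of `[0, t]` gives the converse. No right-continuity of the filtration is
needed. -/
lemma isStoppingTime_exitTime (hB : IsBrownianMotion 𝓕 B P) {p : ℝ}
    (hp : p ∈ Set.Icc (0 : ℝ) 1) : IsStoppingTime 𝓕 (exitTime B p) := by
  intro t
  obtain ⟨D, hDc, hDd⟩ := TopologicalSpace.exists_countable_dense (Set.Iic t)
  have key : {ω | exitTime B p ω ≤ t} = ⋂ n : ℕ, ⋃ s ∈ D,
      ({ω | p + B s ω < 1 / ((n : ℝ) + 1)} ∪ {ω | 1 - 1 / ((n : ℝ) + 1) < p + B s ω}) := by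
    ext ω
    have hf : Continuous fun s => p + B s ω := continuous_const.add (hB.continuous_path ω)
    simp only [Set.mem_ofPred_eq, Set.mem_iInter, Set.mem_iUnion, Set.mem_union, exists_prop]
    constructor
    · intro h n
      have hn : (0 : ℝ) < 1 / ((n : ℝ) + 1) := by positivity
      rcases exitTime_eq_top_or hB hp ω with ⟨h', -⟩ | ⟨u, hu, -, hb⟩
      · rw [h'] at h
        exact absurd (top_le_iff.1 h) WithTop.coe_ne_top
      · rw [hu, WithTop.coe_le_coe] at h
        have hopen : IsOpen {s : Set.Iic t | p + B s ω < 1 / ((n : ℝ) + 1) ∨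
            1 - 1 / ((n : ℝ) + 1) < p + B s ω} :=
          (isOpen_lt (hf.comp continuous_subtype_val) continuous_const).union
            (isOpen_lt continuous_const (hf.comp continuous_subtype_val))
        obtain ⟨s, hsD, hs⟩ := hDd.exists_mem_open hopen ⟨⟨u, h⟩, by
          rcases hb with hb | hb
          · left; simpa [hb] using hn
          · right; simp only [hb]; linarith⟩
        exact ⟨s, hsD, hs⟩
    · intro h
      by_contra hlt
      rw [not_le] at hlt
      have hin : ∀ s ∈ Set.Iic t, p + B s ω ∈ Set.Ioo (0 : ℝ) 1 := by
        intro s hs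
        rcases exitTime_eq_top_or hB hp ω with ⟨-, h'⟩ | ⟨u, hu, h', -⟩
        · exact h' s
        · rw [hu, WithTop.coe_lt_coe] at hlt
          exact h' s (lt_of_le_of_lt hs hlt)
      have hcomp : IsCompact (Set.Iic t) := by
        rw [← Set.Icc_bot]
        exact isCompact_Icc
      -- A path that stays inside the open interval has a positive distance to its ends on the
      -- compact time interval, contradicting the approximation for large `n`.
      obtain ⟨a, ha, hmin⟩ := hcomp.exists_isMinOn ⟨t, Set.self_mem_Iic⟩ hf.continuousOn
      obtain ⟨b, hb, hmax⟩ := hcomp.exists_isMaxOn ⟨t, Set.self_mem_Iic⟩ hf.continuousOn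
      obtain ⟨n, hn⟩ := exists_nat_one_div_lt
        (lt_min (hin a ha).1 (sub_pos.2 (hin b hb).2))
      obtain ⟨s, hsD, hs⟩ := h n
      have h1 := hmin s.2
      have h2 := hmax s.2
      simp only [Set.mem_ofPred_eq] at h1 h2
      have h3 := lt_min_iff.1 hn
      rcases hs with hs | hs <;> linarith [h3.1, h3.2]
  rw [key]
  refine MeasurableSet.iInter fun n => MeasurableSet.biUnion hDc fun s _ => ?_
  have hm : Measurable[𝓕 t] fun ω => p + B s ω :=
    (((hB.adapted s).mono (𝓕.mono s.2) le_rfl).const_add p)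
  exact (hm measurableSet_Iio).union (hm measurableSet_Ioi)

lemma stronglyAdapted_add (hB : IsBrownianMotion 𝓕 B P) (p : ℝ) :
    StronglyAdapted 𝓕 fun t ω => p + B t ω :=
  fun t => ((hB.adapted t).const_add p).stronglyMeasurable

lemma isStronglyProgressive_state (hB : IsBrownianMotion 𝓕 B P) {p : ℝ}
    (hp : p ∈ Set.Icc (0 : ℝ) 1) : IsStronglyProgressive 𝓕 (state B p) :=
  IsStronglyProgressive.stoppedProcess
    ((stronglyAdapted_add hB p).isStronglyProgressive_of_continuous
      fun ω => continuous_const.add (hB.continuous_path ω))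
    (isStoppingTime_exitTime hB hp)

lemma measurable_state (hB : IsBrownianMotion 𝓕 B P) {p : ℝ} (hp : p ∈ Set.Icc (0 : ℝ) 1)
    (t : ℝ≥0) : Measurable[𝓕 t] (state B p t) :=
  ((isStronglyProgressive_state hB hp).stronglyAdapted t).measurable

lemma setOf_exists_state_eq (hB : IsBrownianMotion 𝓕 B P) {p : ℝ} (hp : p ∈ Set.Icc (0 : ℝ) 1)
    {b : ℝ} (hb : b = 0 ∨ b = 1) :
    {ω | ∃ t, state B p t ω = b} = ⋃ n : ℕ, {ω | state B p n ω = b} := by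
  ext ω
  simp only [Set.mem_ofPred_eq, Set.mem_iUnion]
  refine ⟨fun ⟨t, ht⟩ => ?_, fun ⟨n, hn⟩ => ⟨n, hn⟩⟩
  obtain ⟨n, hn⟩ := exists_nat_ge t
  exact ⟨n, state_absorbing hB hp hb hn ht⟩

lemma measurableSet_exists_state_eq (hB : IsBrownianMotion 𝓕 B P) {p : ℝ}
    (hp : p ∈ Set.Icc (0 : ℝ) 1) {b : ℝ} (hb : b = 0 ∨ b = 1) :
    MeasurableSet {ω | ∃ t, state B p t ω = b} := by
  rw [setOf_exists_state_eq hB hp hb]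
  exact MeasurableSet.iUnion fun n =>
    𝓕.le _ _ (measurable_state hB hp n (measurableSet_singleton b))

/-- The density is at most `1 / √v`, and the interval has length `2`. -/
lemma gaussianReal_Icc_le {v : ℝ≥0} (hv : v ≠ 0) :
    gaussianReal 0 v (Set.Icc (-1) 1) ≤ ENNReal.ofReal (2 * (√v)⁻¹) := by
  rw [gaussianReal_apply _ hv]
  have hle : ∀ x, gaussianPDF 0 v x ≤ ENNReal.ofReal ((√v)⁻¹) := by
    intro x
    rw [gaussianPDF, gaussianPDFReal]
    have hv' : (0 : ℝ) < v := by exact_mod_cast pos_iff_ne_zero.2 hv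
    refine ENNReal.ofReal_le_ofReal ?_
    calc (√(2 * Real.pi * v))⁻¹ * Real.exp (-(x - 0) ^ 2 / (2 * v))
        ≤ (√v)⁻¹ * 1 := by
          refine mul_le_mul ?_ ?_ (by positivity) (by positivity)
          · refine inv_anti₀ (Real.sqrt_pos.2 hv') (Real.sqrt_le_sqrt ?_)
            nlinarith [Real.pi_gt_three]
          · rw [Real.exp_le_one_iff]
            exact div_nonpos_of_nonpos_of_nonneg (by nlinarith [sq_nonneg (x - 0)]) (by positivity)
      _ = (√v)⁻¹ := mul_one _
  calc ∫⁻ x in Set.Icc (-1) 1, gaussianPDF 0 v x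
      ≤ ∫⁻ _ in Set.Icc (-1 : ℝ) 1, ENNReal.ofReal ((√v)⁻¹) := lintegral_mono fun x => hle x
    _ = ENNReal.ofReal (2 * (√v)⁻¹) := by
      rw [setLIntegral_const, Real.volume_Icc, mul_comm, ← ENNReal.ofReal_mul (by norm_num)]
      norm_num

/-- The walk is almost surely frozen eventually. -/
lemma ae_exitTime_ne_top (hB : IsBrownianMotion 𝓕 B P) {p : ℝ} (hp : p ∈ Set.Icc (0 : ℝ) 1) :
    ∀ᵐ ω ∂P, exitTime B p ω ≠ ⊤ := by
  rw [ae_iff]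
  simp only [not_not]
  have hle : ∀ n : ℕ, P {ω | exitTime B p ω = ⊤} ≤ ENNReal.ofReal (2 * (√((n : ℝ) + 1))⁻¹) := by
    intro n
    have hlaw := hB.brownian.hasLaw_eval (n + 1 : ℝ≥0)
    -- A walk that is never frozen keeps `|B| ≤ 1` at all times, which has probability at most `2 /
    -- √(n + 1)` at time `n + 1`.
    calc P {ω | exitTime B p ω = ⊤} ≤ P (B (n + 1 : ℝ≥0) ⁻¹' Set.Icc (-1) 1) := by
          refine measure_mono fun ω hω => ?_
          rcases exitTime_eq_top_or hB hp ω with ⟨-, h⟩ | ⟨u, h, -⟩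
          · have := h (n + 1)
            exact ⟨by linarith [this.1, hp.2], by linarith [this.2, hp.1]⟩
          · rw [Set.mem_ofPred_eq, h] at hω
            exact absurd hω WithTop.coe_ne_top
      _ = gaussianReal 0 (n + 1) (Set.Icc (-1) 1) := by
          rw [← hlaw.map_eq, Measure.map_apply_of_aemeasurable hlaw.aemeasurable measurableSet_Icc]
      _ ≤ _ := by
          have := gaussianReal_Icc_le (v := n + 1) (by positivity)
          simpa using this
  have hlim : Tendsto (fun n : ℕ => ENNReal.ofReal (2 * (√((n : ℝ) + 1))⁻¹)) atTop (𝓝 0) := by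
    rw [← ENNReal.ofReal_zero]
    refine (ENNReal.continuous_ofReal.tendsto 0).comp ?_
    have h1 : Tendsto (fun n : ℕ => √((n : ℝ) + 1)) atTop atTop :=
      Real.tendsto_sqrt_atTop.comp
        (tendsto_atTop_add_const_right _ _ tendsto_natCast_atTop_atTop)
    simpa using h1.inv_tendsto_atTop.const_mul 2
  exact le_antisymm (ge_of_tendsto' hlim hle) zero_le

/-! ### Restriction of random times to events. -/

open scoped Classical in
/-- The random time `T`, restricted to the event `G`. -/
def restrictTime (G : Set Ω) (T : Ω → WithTop ℝ≥0) (ω : Ω) : WithTop ℝ≥0 :=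
  if ω ∈ G then T ω else ⊤

lemma restrictTime_of_mem {G : Set Ω} {T : Ω → WithTop ℝ≥0} {ω : Ω} (h : ω ∈ G) :
    restrictTime G T ω = T ω :=
  if_pos h

lemma restrictTime_of_notMem {G : Set Ω} {T : Ω → WithTop ℝ≥0} {ω : Ω} (h : ω ∉ G) :
    restrictTime G T ω = ⊤ :=
  if_neg h

lemma restrictTime_ne_top_iff {G : Set Ω} {T : Ω → WithTop ℝ≥0} {ω : Ω} :
    restrictTime G T ω ≠ ⊤ ↔ ω ∈ G ∧ T ω ≠ ⊤ := by
  by_cases h : ω ∈ G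
  · simp [restrictTime_of_mem h, h]
  · simp [restrictTime_of_notMem h, h]

/-- On `G` the event `S ≤ t` entails `T ≤ t`, and by then it is known whether `G` has occurred. -/
lemma isStoppingTime_restrictTime {T S : Ω → WithTop ℝ≥0} (hT : IsStoppingTime 𝓕 T)
    (hS : IsStoppingTime 𝓕 S) {G : Set Ω} (hG : MeasurableSet[hT.measurableSpace] G)
    (hle : ∀ ω ∈ G, T ω ≤ S ω) : IsStoppingTime 𝓕 (restrictTime G S) := by
  intro t
  have h := (hG.2 t).inter (hS t)
  convert h using 1
  ext ω
  simp only [Set.mem_ofPred_eq, Set.mem_inter_iff]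
  by_cases hω : ω ∈ G
  · rw [restrictTime_of_mem hω]
    exact ⟨fun h => ⟨⟨hω, (hle ω hω).trans h⟩, h⟩, fun h => h.2⟩
  · rw [restrictTime_of_notMem hω]
    exact ⟨fun h => absurd (top_le_iff.1 h) WithTop.coe_ne_top, fun h => absurd h.1.1 hω⟩

/-! ### The walk from a player's side, and optional stopping of the frozen walk. -/

/-- The state seen by a player. -/
def Player.own : Player → ℝ → ℝ
  | .A, q => q
  | .B, q => 1 - q

/-- The event that the walk started at `p` ends in a win of the player `i`. -/
def won (B : ℝ≥0 → Ω → ℝ) (p : ℝ) (i : Player) : Set Ω :=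
  {ω | ∃ t, i.own (state B p t ω) = 1}

lemma Player.own_mem_Icc (i : Player) {q : ℝ} (hq : q ∈ Set.Icc (0 : ℝ) 1) :
    i.own q ∈ Set.Icc (0 : ℝ) 1 := by
  cases i
  · exact hq
  · exact ⟨by simp only [Player.own]; linarith [hq.2], by simp only [Player.own]; linarith [hq.1]⟩

lemma Player.own_opp (i : Player) (q : ℝ) : i.opp.own q = 1 - i.own q := by
  cases i <;> simp [Player.own, Player.opp]

@[simp]
lemma Player.opp_opp (i : Player) : i.opp.opp = i := by cases i <;> rfl

@[simp]
lemma Player.sign_opp (i : Player) : i.opp.sign = -i.sign := by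
  cases i <;> simp [Player.sign, Player.opp]

lemma Player.opp_ne (i : Player) : i.opp ≠ i := by cases i <;> simp [Player.opp]

lemma Player.eq_opp_of_ne {i j : Player} (h : j ≠ i) : j = i.opp := by
  cases i <;> cases j <;> simp_all [Player.opp]

lemma Player.continuous_own (i : Player) : Continuous i.own := by
  cases i
  · exact continuous_id
  · exact continuous_const.sub continuous_id

lemma won_A (B : ℝ≥0 → Ω → ℝ) (p : ℝ) : won B p .A = {ω | ∃ t, state B p t ω = 1} := rfl

lemma won_B (B : ℝ≥0 → Ω → ℝ) (p : ℝ) : won B p .B = {ω | ∃ t, state B p t ω = 0} := by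
  simp [won, Player.own]

lemma evaluation_eq_won (i : Player) (q : ℝ) : evaluation P B i q = P.real (won B q i) := by
  cases i
  · rfl
  · rw [won_B]; rfl

lemma own_absorbing (hB : IsBrownianMotion 𝓕 B P) {p : ℝ} (hp : p ∈ Set.Icc (0 : ℝ) 1)
    (i : Player) {b : ℝ} (hb : b = 0 ∨ b = 1) {s t : ℝ≥0} (hst : s ≤ t) {ω : Ω}
    (h : i.own (state B p s ω) = b) : i.own (state B p t ω) = b := by
  cases i
  · exact state_absorbing hB hp hb hst h
  · simp only [Player.own] at h ⊢
    rw [state_absorbing (b := 1 - b) hB hp (by rcases hb with rfl | rfl <;> simp) hst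
      (by linarith)]
    ring

lemma measurableSet_won (hB : IsBrownianMotion 𝓕 B P) {p : ℝ} (hp : p ∈ Set.Icc (0 : ℝ) 1)
    (i : Player) : MeasurableSet (won B p i) := by
  cases i
  · exact measurableSet_exists_state_eq hB hp (Or.inr rfl)
  · rw [won_B]
    exact measurableSet_exists_state_eq hB hp (Or.inl rfl)

lemma disjoint_won (hB : IsBrownianMotion 𝓕 B P) {p : ℝ} (hp : p ∈ Set.Icc (0 : ℝ) 1)
    (i : Player) : Disjoint (won B p i) (won B p i.opp) := by
  rw [Set.disjoint_left]
  rintro ω ⟨s, hs⟩ ⟨t, ht⟩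
  rw [Player.own_opp] at ht
  have h1 := own_absorbing hB hp i (Or.inr rfl) (le_max_left s t) hs
  have h2 := own_absorbing hB hp i (b := 0) (Or.inl rfl) (le_max_right s t) (by linarith)
  linarith

lemma ae_won_or (hB : IsBrownianMotion 𝓕 B P) {p : ℝ} (hp : p ∈ Set.Icc (0 : ℝ) 1) (i : Player) :
    ∀ᵐ ω ∂P, ω ∈ won B p i ∨ ω ∈ won B p i.opp := by
  filter_upwards [ae_exitTime_ne_top hB hp] with ω hω
  suffices ω ∈ won B p .A ∨ ω ∈ won B p .B by
    cases i
    · exact this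
    · exact this.symm
  rw [won_A, won_B]
  rcases state_cases hB hp ω with ⟨h, -⟩ | ⟨u, -, -, h | h⟩
  · exact absurd h hω
  · exact Or.inr ⟨u, h u le_rfl⟩
  · exact Or.inl ⟨u, h u le_rfl⟩

lemma measurable_state_stopped (hB : IsBrownianMotion 𝓕 B P) {p : ℝ}
    (hp : p ∈ Set.Icc (0 : ℝ) 1) {T : Ω → WithTop ℝ≥0} (hT : IsStoppingTime 𝓕 T) :
    Measurable[hT.measurableSpace] fun ω => state B p (T ω).untopA ω :=
  measurable_stoppedValue (isStronglyProgressive_state hB hp) hT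

lemma state_eq_indicator_of_exitTime_le (hB : IsBrownianMotion 𝓕 B P) {p : ℝ}
    (hp : p ∈ Set.Icc (0 : ℝ) 1) {t : ℝ≥0} {ω : Ω} (h : exitTime B p ω ≤ t) :
    state B p t ω = (won B p .A).indicator 1 ω := by
  rcases state_cases hB hp ω with ⟨h', -⟩ | ⟨u, hu, -, hb⟩
  · rw [h'] at h
    exact absurd (top_le_iff.1 h) WithTop.coe_ne_top
  · rw [hu, WithTop.coe_le_coe] at h
    rcases hb with hb | hb
    · have : ω ∉ won B p .A := fun hA =>
        Set.disjoint_left.1 (disjoint_won hB hp .A) hA (by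
          change ω ∈ won B p .B
          rw [won_B]
          exact ⟨t, hb t h⟩)
      rw [Set.indicator_of_notMem this, hb t h]
    · have : ω ∈ won B p .A := ⟨t, hb t h⟩
      rw [Set.indicator_of_mem this, hb t h, Pi.one_apply]

/-- Optional stopping of the walk between `T` and the fixed time `N`, on the event that `T` comes
before `N` and before the walk is frozen. -/
lemma setIntegral_state_eq_of_le [IsProbabilityMeasure P] (hB : IsBrownianMotion 𝓕 B P) {p : ℝ}
    (hp : p ∈ Set.Icc (0 : ℝ) 1) {T : Ω → WithTop ℝ≥0} (hT : IsStoppingTime 𝓕 T) (N : ℝ≥0) :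
    ∫ ω in {ω | T ω ≤ exitTime B p ω ∧ T ω ≤ N}, state B p (T ω).untopA ω ∂P =
      ∫ ω in {ω | T ω ≤ exitTime B p ω ∧ T ω ≤ N}, state B p N ω ∂P := by
  set G := {ω | T ω ≤ exitTime B p ω ∧ T ω ≤ N} with hG
  have hτ := isStoppingTime_exitTime hB hp
  have hGT : MeasurableSet[hT.measurableSpace] G :=
    (hT.measurableSet_le_stopping_time hτ).inter (hT.measurableSet_le' N)
  have hGm : MeasurableSet G := hT.measurableSpace_le _ hGT
  have hfin : ∀ ω ∈ G, ∃ r : ℝ≥0, T ω = r := fun ω hω => by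
    obtain ⟨r, hr⟩ := WithTop.ne_top_iff_exists.1 (ne_top_of_le_ne_top WithTop.coe_ne_top hω.2)
    exact ⟨r, hr.symm⟩
  have hfin2 : ∀ ω, ∃ r : ℝ≥0, min (exitTime B p ω) N = r := fun ω => by
    obtain ⟨r, hr⟩ := WithTop.ne_top_iff_exists.1
      (ne_top_of_le_ne_top WithTop.coe_ne_top (min_le_right (exitTime B p ω) N))
    exact ⟨r, hr.symm⟩
  -- Optional stopping of `B` is applied at `T` and at `min (exitTime B p) N`, both restricted to
  -- `G`. On `G` neither exceeds the freezing time, so `p + B` there is the state at `T` and at `N`,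
  -- respectively. Both integrals of `B` equal that of `B N`.
  have h1s : IsStoppingTime 𝓕 (restrictTime G T) :=
    isStoppingTime_restrictTime hT hT hGT fun ω _ => le_rfl
  have h2s : IsStoppingTime 𝓕 (restrictTime G fun ω => min (exitTime B p ω) N) :=
    isStoppingTime_restrictTime hT (hτ.min_const N) hGT fun ω hω => le_min hω.1 hω.2
  have hset1 : {ω | restrictTime G T ω ≠ ⊤} = G := by
    ext ω
    rw [Set.mem_ofPred_eq, restrictTime_ne_top_iff]
    exact ⟨fun h => h.1, fun h => ⟨h, ne_top_of_le_ne_top WithTop.coe_ne_top h.2⟩⟩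
  have hset2 : {ω | restrictTime G (fun ω => min (exitTime B p ω) N) ω ≠ ⊤} = G := by
    ext ω
    rw [Set.mem_ofPred_eq, restrictTime_ne_top_iff]
    exact ⟨fun h => h.1, fun h => ⟨h, ne_top_of_le_ne_top WithTop.coe_ne_top (min_le_right _ _)⟩⟩
  have hv1 : ∀ ω ∈ G, state B p (T ω).untopA ω = p + B (restrictTime G T ω).untopA ω := by
    intro ω hω
    obtain ⟨r, hr⟩ := hfin ω hω
    rw [restrictTime_of_mem hω, hr]
    exact state_of_le (hr ▸ hω.1)
  have hv2 : ∀ ω ∈ G, state B p N ω =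
      p + B (restrictTime G (fun ω => min (exitTime B p ω) N) ω).untopA ω := by
    intro ω hω
    rw [restrictTime_of_mem hω]
    rcases le_total (exitTime B p ω) N with h | h
    · obtain ⟨r, hr⟩ := hfin2 ω
      rw [hr]
      rw [min_eq_left h] at hr
      exact state_of_ge hr (WithTop.coe_le_coe.1 (hr ▸ h))
    · rw [min_eq_right h]
      exact state_of_le h
  have hbd : ∀ {q b : ℝ}, q ∈ Set.Icc (0 : ℝ) 1 → q = p + b → |b| ≤ 1 := fun hq h =>
    abs_le.2 ⟨by linarith [hq.1, hp.2], by linarith [hq.2, hp.1]⟩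
  have hM := hB.martingale
  have e1 := setIntegral_continuous_martingale_eq hM hB.continuous_path h1s (N := N) (C := 1)
    (fun ω hω => by
      have hωG : ω ∈ G := (restrictTime_ne_top_iff.1 hω).1
      rw [restrictTime_of_mem hωG]; exact hωG.2)
    (fun ω hω => hbd (state_mem_Icc hB hp _ ω) (hv1 ω (restrictTime_ne_top_iff.1 hω).1))
  have e2 := setIntegral_continuous_martingale_eq hM hB.continuous_path h2s (N := N) (C := 1)
    (fun ω hω => by
      have hωG : ω ∈ G := (restrictTime_ne_top_iff.1 hω).1
      rw [restrictTime_of_mem hωG]; exact min_le_right _ _)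
    (fun ω hω => hbd (state_mem_Icc hB hp _ ω) (hv2 ω (restrictTime_ne_top_iff.1 hω).1))
  rw [hset1] at e1
  rw [hset2] at e2
  have hint : ∀ S : Ω → WithTop ℝ≥0, IsStoppingTime 𝓕 S →
      (∀ ω ∈ G, |B (S ω).untopA ω| ≤ 1) → IntegrableOn (fun ω => B (S ω).untopA ω) G P := by
    intro S hS hb
    have hm : Measurable (stoppedValue B S) :=
      (measurable_stoppedValue (hM.stronglyAdapted.isStronglyProgressive_of_continuous
        hB.continuous_path) hS).mono hS.measurableSpace_le le_rfl
    exact Measure.integrableOn_of_bounded (M := 1) (measure_ne_top _ _) hm.aestronglyMeasurable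
      ((ae_restrict_iff' hGm).2 (ae_of_all _ fun ω h => hb ω h))
  rw [setIntegral_congr_fun hGm hv1, setIntegral_congr_fun hGm hv2,
    integral_add (integrable_const p) (hint _ h1s fun ω hω =>
      hbd (state_mem_Icc hB hp _ ω) (hv1 ω hω)),
    integral_add (integrable_const p) (hint _ h2s fun ω hω =>
      hbd (state_mem_Icc hB hp _ ω) (hv2 ω hω)), e1, e2]

/-- The state at a large time `N` is almost surely the final one, so this is the limit `N → ∞` of
the preceding identity, by dominated convergence. Paths on which `T` comes after freezing are
outside every `G n`, but there the state at `T` already is the final one. -/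
lemma setIntegral_state [IsProbabilityMeasure P] (hB : IsBrownianMotion 𝓕 B P) {p : ℝ}
    (hp : p ∈ Set.Icc (0 : ℝ) 1) {T : Ω → WithTop ℝ≥0} (hT : IsStoppingTime 𝓕 T) :
    ∫ ω in {ω | T ω ≠ ⊤}, state B p (T ω).untopA ω ∂P =
      ∫ ω in {ω | T ω ≠ ⊤}, (won B p .A).indicator 1 ω ∂P := by
  have hτ := isStoppingTime_exitTime hB hp
  have hfm : MeasurableSet {ω | T ω ≠ ⊤} := hT.measurableSet_eq_top.compl
  set W : Ω → ℝ := (won B p .A).indicator 1 with hW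
  have hWm : Measurable W := measurable_one.indicator (measurableSet_won hB hp .A)
  have hWI : ∀ ω, W ω ∈ Set.Icc (0 : ℝ) 1 := fun ω => by
    by_cases h : ω ∈ won B p .A <;> simp [hW, h]
  set Y : Ω → ℝ := fun ω => state B p (T ω).untopA ω with hY
  have hYm : Measurable Y := (measurable_state_stopped hB hp hT).mono hT.measurableSpace_le le_rfl
  have hYI : ∀ ω, Y ω ∈ Set.Icc (0 : ℝ) 1 := fun ω => state_mem_Icc hB hp _ ω
  have hXm : ∀ n : ℕ, Measurable (state B p n) := fun n =>
    (measurable_state hB hp n).mono (𝓕.le _) le_rfl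
  set G : ℕ → Set Ω := fun n => {ω | T ω ≤ exitTime B p ω ∧ T ω ≤ ((n : ℝ≥0) : WithTop ℝ≥0)}
    with hG
  have hGm : ∀ n, MeasurableSet (G n) := fun n => hT.measurableSpace_le _
    ((hT.measurableSet_le_stopping_time hτ).inter (hT.measurableSet_le' n))
  have hi : ∀ (f : Ω → ℝ), Measurable f → (∀ ω, f ω ∈ Set.Icc (0 : ℝ) 1) → Integrable f P :=
    fun f hf hI => Integrable.of_bound hf.aestronglyMeasurable 1 (ae_of_all _ fun ω => by
      rw [Real.norm_eq_abs, abs_of_nonneg (hI ω).1]; exact (hI ω).2)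
  have hYi := hi Y hYm hYI
  have hWi := hi W hWm hWI
  have hXi : ∀ n : ℕ, Integrable (state B p n) P := fun n =>
    hi _ (hXm n) fun ω => state_mem_Icc hB hp _ ω
  have hzero : ∀ n, ∫ ω, (G n).indicator (fun ω => state B p n ω - Y ω) ω ∂P = 0 := by
    intro n
    rw [integral_indicator (hGm n), integral_sub (hXi n).integrableOn hYi.integrableOn,
      setIntegral_state_eq_of_le hB hp hT n, sub_self]
  have hlim : Tendsto (fun n => ∫ ω, (G n).indicator (fun ω => state B p n ω - Y ω) ω ∂P) atTop
      (𝓝 (∫ ω, {ω | T ω ≠ ⊤}.indicator (fun ω => W ω - Y ω) ω ∂P)) := by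
    refine tendsto_integral_of_dominated_convergence (fun _ => 1)
      (fun n => (((hXm n).sub hYm).indicator (hGm n)).aestronglyMeasurable)
      (integrable_const 1) (fun n => ae_of_all _ fun ω => ?_) ?_
    · by_cases h : ω ∈ G n
      · rw [Set.indicator_of_mem h, Real.norm_eq_abs, abs_le]
        have h1 := state_mem_Icc hB hp n ω
        have h2 := hYI ω
        exact ⟨by linarith [h1.1, h2.2], by linarith [h1.2, h2.1]⟩
      · simp [Set.indicator_of_notMem h]
    · filter_upwards [ae_exitTime_ne_top hB hp] with ω hω
      obtain ⟨u, hu⟩ := WithTop.ne_top_iff_exists.1 hω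
      by_cases hTω : T ω = ⊤
      · rw [Set.indicator_of_notMem (by simpa using hTω)]
        refine tendsto_const_nhds.congr fun n => ?_
        rw [Set.indicator_of_notMem fun h : ω ∈ G n => absurd (top_le_iff.1 (hTω ▸ h.2))
          WithTop.coe_ne_top]
      · rw [Set.indicator_of_mem (by simpa using hTω)]
        obtain ⟨r, hr⟩ := WithTop.ne_top_iff_exists.1 hTω
        have hYr : Y ω = state B p r ω := by simp only [hY, ← hr]; rfl
        refine tendsto_const_nhds.congr' ?_
        obtain ⟨m, hm⟩ := exists_nat_ge (max r u)
        filter_upwards [eventually_ge_atTop m] with n hn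
        have hmn : (m : ℝ≥0) ≤ n := by exact_mod_cast hn
        by_cases hru : r ≤ u
        · have hmem : ω ∈ G n := by
            refine ⟨by rw [← hr, ← hu]; exact WithTop.coe_le_coe.2 hru, ?_⟩
            rw [← hr]
            exact WithTop.coe_le_coe.2 (((le_max_left r u).trans hm).trans hmn)
          rw [Set.indicator_of_mem hmem, state_eq_indicator_of_exitTime_le hB hp]
          rw [← hu]
          exact WithTop.coe_le_coe.2 (((le_max_right r u).trans hm).trans hmn)
        · have hmem : ω ∉ G n := fun h => hru (by
            have := h.1
            rwa [← hr, ← hu, WithTop.coe_le_coe] at this)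
          rw [Set.indicator_of_notMem hmem, hYr, state_eq_indicator_of_exitTime_le hB hp, sub_self]
          rw [← hu]
          exact WithTop.coe_le_coe.2 (not_le.1 hru).le
  have h0 : ∫ ω, {ω | T ω ≠ ⊤}.indicator (fun ω => W ω - Y ω) ω ∂P = 0 := by
    refine tendsto_nhds_unique hlim ?_
    simp only [hzero]
    exact tendsto_const_nhds
  rw [integral_indicator hfm, integral_sub hWi.integrableOn hYi.integrableOn, sub_eq_zero] at h0
  exact h0.symm

/-- The expected state at a stopping time is the probability of winning from then on. -/
theorem setIntegral_own_state [IsProbabilityMeasure P] (hB : IsBrownianMotion 𝓕 B P) {p : ℝ}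
    (hp : p ∈ Set.Icc (0 : ℝ) 1) (i : Player) {T : Ω → WithTop ℝ≥0} (hT : IsStoppingTime 𝓕 T) :
    ∫ ω in {ω | T ω ≠ ⊤}, i.own (state B p (T ω).untopA ω) ∂P =
      ∫ ω in {ω | T ω ≠ ⊤}, (won B p i).indicator 1 ω ∂P := by
  have hA := setIntegral_state hB hp hT
  have hYm : Measurable fun ω => state B p (T ω).untopA ω :=
    (measurable_state_stopped hB hp hT).mono hT.measurableSpace_le le_rfl
  have hYi : Integrable (fun ω => state B p (T ω).untopA ω) P :=
    Integrable.of_bound hYm.aestronglyMeasurable 1 (ae_of_all _ fun ω => by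
      have := state_mem_Icc hB hp (T ω).untopA ω
      rw [Real.norm_eq_abs, abs_of_nonneg this.1]; exact this.2)
  cases i with
  | A => exact hA
  | B =>
    have hWi : Integrable ((won B p .A).indicator (1 : Ω → ℝ)) P :=
      (integrable_const (1 : ℝ)).indicator (measurableSet_won hB hp .A)
    -- Almost surely exactly one player wins, which reduces the claim for Player B to that for
    -- Player A.
    have hae : (won B p .B).indicator (1 : Ω → ℝ) =ᵐ[P.restrict {ω | T ω ≠ ⊤}]
        fun ω => 1 - (won B p .A).indicator (1 : Ω → ℝ) ω := by
      refine ae_restrict_of_ae ?_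
      filter_upwards [ae_won_or hB hp .A] with ω hω
      rcases hω with h | h
      · have : ω ∉ won B p .B := Set.disjoint_left.1 (disjoint_won hB hp .A) h
        simp [h, this]
      · have h : ω ∈ won B p .B := h
        have : ω ∉ won B p .A := Set.disjoint_right.1 (disjoint_won hB hp .A) h
        simp [h, this]
    rw [integral_congr_ae hae]
    simp only [Player.own]
    rw [integral_sub (integrable_const _) hYi.integrableOn,
      integral_sub (integrable_const _) hWi.integrableOn, hA]

/-- The evaluation of a player is the state seen by this player. -/
theorem evaluation_eq [IsProbabilityMeasure P] (hB : IsBrownianMotion 𝓕 B P) {q : ℝ}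
    (hq : q ∈ Set.Icc (0 : ℝ) 1) (i : Player) : evaluation P B i q = i.own q := by
  -- Optional stopping at time `0`, where the state is still `q`.
  have h := setIntegral_own_state hB hq i (isStoppingTime_const 𝓕 0)
  have hs : {ω : Ω | ((0 : ℝ≥0) : WithTop ℝ≥0) ≠ ⊤} = Set.univ := by simp
  have hu : ((0 : ℝ≥0) : WithTop ℝ≥0).untopA = 0 := rfl
  rw [hs, setIntegral_univ, setIntegral_univ, hu,
    integral_indicator_one (measurableSet_won hB hq i)] at h
  simp only [state_zero hB, integral_const, probReal_univ, one_smul] at h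
  rw [evaluation_eq_won, h]

/-! ### Decomposition of a stage into its possible courses. -/

/-- The time at which the player `j` intends to double in the stage `(k, h)` that begins at `ρ`. -/
def offerTime (σ : Player → Strategy Ω) (k : ℕ) (h : Option Player) (ρ : Ω → WithTop ℝ≥0)
    (j : Player) (ω : Ω) : WithTop ℝ≥0 :=
  WithTop.recTopCoe (C := fun _ => WithTop ℝ≥0) ⊤ (fun t : ℝ≥0 => (σ j).propose k h t ω) (ρ ω)

/-- The event that the stage `(k, h)` begins and `j` is the player whose offer counts in it. -/
def offerEvent (first : Player) (σ : Player → Strategy Ω) (k : ℕ) (h : Option Player)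
    (ρ : Ω → WithTop ℝ≥0) (j : Player) : Set Ω :=
  {ω | ∃ t : ℝ≥0, ρ ω = t ∧ proposer first σ k h t ω = j}

/-- The event that the opponent accepts the double which `j` intends to offer. -/
def acceptEvent (σ : Player → Strategy Ω) (k : ℕ) (h : Option Player) (ρ : Ω → WithTop ℝ≥0)
    (j : Player) : Set Ω :=
  {ω | ∃ u : ℝ≥0, offerTime σ k h ρ j ω = u ∧ ω ∈ (σ j.opp).accept k h u}

/-- The time of an accepted double offered by `j`. -/
def acceptTime (first : Player) (σ : Player → Strategy Ω) (k : ℕ) (h : Option Player)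
    (ρ : Ω → WithTop ℝ≥0) (j : Player) : Ω → WithTop ℝ≥0 :=
  restrictTime (offerEvent first σ k h ρ j ∩ acceptEvent σ k h ρ j) (offerTime σ k h ρ j)

/-- The time of a declined double offered by `j`. -/
def declineTime (first : Player) (σ : Player → Strategy Ω) (k : ℕ) (h : Option Player)
    (ρ : Ω → WithTop ℝ≥0) (j : Player) : Ω → WithTop ℝ≥0 :=
  restrictTime (offerEvent first σ k h ρ j ∩ (acceptEvent σ k h ρ j)ᶜ) (offerTime σ k h ρ j)

/-- The event that the stage begins and no double is offered in it. -/
def endEvent (first : Player) (σ : Player → Strategy Ω) (k : ℕ) (h : Option Player)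
    (ρ : Ω → WithTop ℝ≥0) : Set Ω :=
  {ω | ρ ω ≠ ⊤ ∧ ∀ j, acceptTime first σ k h ρ j ω = ⊤ ∧ declineTime first σ k h ρ j ω = ⊤}

/-- Player A's payoff from the stage `(k, h)` that begins at the random time `ρ`. -/
def payAt (x y : ℝ) (B : ℝ≥0 → Ω → ℝ) (p : ℝ) (first : Player) (σ : Player → Strategy Ω) (k : ℕ)
    (h : Option Player) (ρ : Ω → WithTop ℝ≥0) (ω : Ω) : ℝ :=
  WithTop.recTopCoe (C := fun _ => ℝ) 0 (fun t : ℝ≥0 => payoff x y B p first σ k h t ω) (ρ ω)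

lemma payAt_top {x y p : ℝ} {first : Player} {σ : Player → Strategy Ω} {k : ℕ}
    {h : Option Player} {ρ : Ω → WithTop ℝ≥0} {ω : Ω} (hω : ρ ω = ⊤) :
    payAt x y B p first σ k h ρ ω = 0 := by
  rw [payAt, hω]; rfl

lemma payAt_coe {x y p : ℝ} {first : Player} {σ : Player → Strategy Ω} {k : ℕ}
    {h : Option Player} {ρ : Ω → WithTop ℝ≥0} {ω : Ω} {t : ℝ≥0} (hω : ρ ω = t) :
    payAt x y B p first σ k h ρ ω = payoff x y B p first σ k h t ω := by
  rw [payAt, hω]; rfl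

section Stage

variable {first : Player} {σ : Player → Strategy Ω} {k : ℕ} {h : Option Player}
  {ρ : Ω → WithTop ℝ≥0} {j : Player} {ω : Ω}

lemma offerTime_coe {t : ℝ≥0} (hω : ρ ω = t) :
    offerTime σ k h ρ j ω = (σ j).propose k h t ω := by
  rw [offerTime, hω]; rfl

lemma offerTime_top (hω : ρ ω = ⊤) : offerTime σ k h ρ j ω = ⊤ := by
  rw [offerTime, hω]; rfl

lemma acceptTime_eq_coe {u : ℝ≥0} (hu : acceptTime first σ k h ρ j ω = u) :
    ω ∈ offerEvent first σ k h ρ j ∧ offerTime σ k h ρ j ω = u ∧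
      ω ∈ (σ j.opp).accept k h u := by
  have hn : acceptTime first σ k h ρ j ω ≠ ⊤ := hu ▸ WithTop.coe_ne_top
  have hm := (restrictTime_ne_top_iff.1 hn).1
  rw [acceptTime, restrictTime_of_mem hm] at hu
  obtain ⟨hm1, v, hv, hm2⟩ := hm
  rw [hu, WithTop.coe_inj] at hv
  exact ⟨hm1, hu, hv ▸ hm2⟩

lemma declineTime_eq_coe {u : ℝ≥0} (hu : declineTime first σ k h ρ j ω = u) :
    ω ∈ offerEvent first σ k h ρ j ∧ offerTime σ k h ρ j ω = u ∧
      ω ∉ (σ j.opp).accept k h u := by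
  have hn : declineTime first σ k h ρ j ω ≠ ⊤ := hu ▸ WithTop.coe_ne_top
  have hm := (restrictTime_ne_top_iff.1 hn).1
  rw [declineTime, restrictTime_of_mem hm] at hu
  exact ⟨hm.1, hu, fun hacc => hm.2 ⟨u, hu, hacc⟩⟩

lemma ne_some_opp_of_mem_offerEvent (hω : ω ∈ offerEvent first σ k h ρ j) : h ≠ some j.opp := by
  rintro rfl
  obtain ⟨t, -, hj⟩ := hω
  exact j.opp_ne hj

lemma acceptTime_of_notMem (hω : ω ∉ offerEvent first σ k h ρ j) :
    acceptTime first σ k h ρ j ω = ⊤ :=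
  restrictTime_of_notMem fun hm => hω hm.1

lemma declineTime_of_notMem (hω : ω ∉ offerEvent first σ k h ρ j) :
    declineTime first σ k h ρ j ω = ⊤ :=
  restrictTime_of_notMem fun hm => hω hm.1

lemma acceptTime_of_offerTime_eq_top (hω : offerTime σ k h ρ j ω = ⊤) :
    acceptTime first σ k h ρ j ω = ⊤ := by
  by_contra hn
  exact (restrictTime_ne_top_iff.1 hn).2 hω

lemma declineTime_of_offerTime_eq_top (hω : offerTime σ k h ρ j ω = ⊤) :
    declineTime first σ k h ρ j ω = ⊤ := by
  by_contra hn
  exact (restrictTime_ne_top_iff.1 hn).2 hω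

/-- The possible courses of a stage. -/
lemma stage_cases (first : Player) (σ : Player → Strategy Ω) (k : ℕ) (h : Option Player)
    (ρ : Ω → WithTop ℝ≥0) (ω : Ω) :
    (ρ ω = ⊤ ∧ ∀ j, acceptTime first σ k h ρ j ω = ⊤ ∧ declineTime first σ k h ρ j ω = ⊤) ∨
    ∃ (t : ℝ≥0) (j : Player), ρ ω = t ∧ proposer first σ k h t ω = j ∧
      (acceptTime first σ k h ρ j.opp ω = ⊤ ∧ declineTime first σ k h ρ j.opp ω = ⊤) ∧
      (((σ j).propose k h t ω = ⊤ ∧ acceptTime first σ k h ρ j ω = ⊤ ∧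
          declineTime first σ k h ρ j ω = ⊤) ∨
        ∃ u : ℝ≥0, (σ j).propose k h t ω = u ∧
          ((ω ∈ (σ j.opp).accept k h u ∧ acceptTime first σ k h ρ j ω = u ∧
              declineTime first σ k h ρ j ω = ⊤) ∨
            (ω ∉ (σ j.opp).accept k h u ∧ acceptTime first σ k h ρ j ω = ⊤ ∧
              declineTime first σ k h ρ j ω = u))) := by
  rcases eq_or_ne (ρ ω) ⊤ with hρ | hρ
  · exact Or.inl ⟨hρ, fun j => ⟨acceptTime_of_offerTime_eq_top (offerTime_top hρ),
      declineTime_of_offerTime_eq_top (offerTime_top hρ)⟩⟩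
  · obtain ⟨t, ht⟩ := WithTop.ne_top_iff_exists.1 hρ
    refine Or.inr ⟨t, _, ht.symm, rfl, ?_, ?_⟩
    · have hn : ω ∉ offerEvent first σ k h ρ (proposer first σ k h t ω).opp := by
        rintro ⟨s, hs, hj⟩
        rw [← ht, WithTop.coe_inj] at hs
        subst hs
        exact Player.opp_ne _ hj.symm
      exact ⟨acceptTime_of_notMem hn, declineTime_of_notMem hn⟩
    · set j := proposer first σ k h t ω with hj
      have hm : ω ∈ offerEvent first σ k h ρ j := ⟨t, ht.symm, rfl⟩
      have hT := offerTime_coe (σ := σ) (k := k) (h := h) (j := j) ht.symm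
      rcases eq_or_ne ((σ j).propose k h t ω) ⊤ with hu | hu
      · exact Or.inl ⟨hu, acceptTime_of_offerTime_eq_top (hT.trans hu),
          declineTime_of_offerTime_eq_top (hT.trans hu)⟩
      · obtain ⟨u, hu⟩ := WithTop.ne_top_iff_exists.1 hu
        refine Or.inr ⟨u, hu.symm, ?_⟩
        rw [← hu] at hT
        by_cases hacc : ω ∈ (σ j.opp).accept k h u
        · have hm' : ω ∈ acceptEvent σ k h ρ j := ⟨u, hT, hacc⟩
          exact Or.inl ⟨hacc, (restrictTime_of_mem (Set.mem_inter hm hm')).trans hT,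
            restrictTime_of_notMem fun hc => hc.2 hm'⟩
        · have hm' : ω ∉ acceptEvent σ k h ρ j := by
            rintro ⟨v, hv, hacc'⟩
            rw [hT, WithTop.coe_inj] at hv
            exact hacc (hv ▸ hacc')
          exact Or.inr ⟨hacc, restrictTime_of_notMem fun hc => hm' hc.2,
            (restrictTime_of_mem (Set.mem_inter hm hm')).trans hT⟩

lemma forall_player_iff {Q : Player → Prop} (i : Player) : (∀ j, Q j) ↔ Q i ∧ Q i.opp := by
  refine ⟨fun hQ => ⟨hQ _, hQ _⟩, fun hQ j => ?_⟩
  by_cases hj : j = i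
  · exact hj ▸ hQ.1
  · exact Player.eq_opp_of_ne hj ▸ hQ.2

/-- A stage that begins either ends without a double, or with an accepted or declined double of
exactly one of the players. -/
lemma indicator_ne_top_eq (first : Player) (σ : Player → Strategy Ω) (k : ℕ) (h : Option Player)
    (ρ : Ω → WithTop ℝ≥0) (i : Player) (f : Ω → ℝ) (ω : Ω) :
    {ω | ρ ω ≠ ⊤}.indicator f ω = (endEvent first σ k h ρ).indicator f ω +
      ({ω | acceptTime first σ k h ρ i ω ≠ ⊤}.indicator f ω +
        {ω | declineTime first σ k h ρ i ω ≠ ⊤}.indicator f ω) +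
      ({ω | acceptTime first σ k h ρ i.opp ω ≠ ⊤}.indicator f ω +
        {ω | declineTime first σ k h ρ i.opp ω ≠ ⊤}.indicator f ω) := by
  classical
  simp only [Set.indicator_apply, endEvent, Set.mem_ofPred_eq, forall_player_iff i]
  rcases stage_cases first σ k h ρ ω with ⟨h1, h2⟩ | ⟨t, j, h1, -, h2, h3⟩
  · simp [h1, h2]
  · by_cases hj : j = i
    · subst hj
      rcases h3 with ⟨-, h3⟩ | ⟨u, -, ⟨-, h3⟩ | ⟨-, h3⟩⟩ <;>
        simp [h1, h2, h3, -ENNReal.some_eq_coe']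
    · obtain rfl := Player.eq_opp_of_ne hj
      rw [Player.opp_opp] at h2
      rcases h3 with ⟨-, h3⟩ | ⟨u, -, ⟨-, h3⟩ | ⟨-, h3⟩⟩ <;>
        simp [h1, h2, h3, -ENNReal.some_eq_coe']

lemma payAt_zero {x y p : ℝ} (ω : Ω) :
    payAt x y B p first σ 0 h ρ ω = {ω | ρ ω ≠ ⊤}.indicator (outcome B p) ω := by
  classical
  rcases eq_or_ne (ρ ω) ⊤ with hρ | hρ
  · rw [payAt_top hρ, Set.indicator_of_notMem (by simpa using hρ)]
  · obtain ⟨t, ht⟩ := WithTop.ne_top_iff_exists.1 hρ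
    rw [payAt_coe ht.symm, Set.indicator_of_mem (by simpa using hρ), payoff]

/-- The summands belong to the disjoint courses of the stage: no double, or a double of either
player that is accepted or declined. Since `payAt` vanishes where the starting time is `⊤`, the
recursive payoffs need no indicator. -/
lemma payAt_succ {x y p : ℝ} (i : Player) (ω : Ω) :
    payAt x y B p first σ (k + 1) h ρ ω =
      (endEvent first σ (k + 1) h ρ).indicator (outcome B p) ω +
      (y * payAt x y B p first σ k (some i.opp) (acceptTime first σ (k + 1) h ρ i) ω +
        {ω | declineTime first σ (k + 1) h ρ i ω ≠ ⊤}.indicator (fun _ => i.sign * x) ω) +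
      (y * payAt x y B p first σ k (some i) (acceptTime first σ (k + 1) h ρ i.opp) ω +
        {ω | declineTime first σ (k + 1) h ρ i.opp ω ≠ ⊤}.indicator
          (fun _ => i.opp.sign * x) ω) := by
  classical
  simp only [Set.indicator_apply, endEvent, Set.mem_ofPred_eq, forall_player_iff i]
  rcases stage_cases first σ (k + 1) h ρ ω with ⟨h1, h2⟩ | ⟨t, j, h1, hprop, h2, h3⟩
  · simp [h1, h2, payAt_top]
  · rw [payAt_coe h1, payoff]
    simp only [hprop]
    by_cases hj : j = i
    · subst hj
      rcases h3 with ⟨h4, h3⟩ | ⟨u, h4, ⟨h5, h3⟩ | ⟨h5, h3⟩⟩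
      · simp [h4, h1, h2, h3, payAt_top, -ENNReal.some_eq_coe']
      · simp [h4, h5, h1, h2, h3, payAt_top, payAt_coe h3.1, -ENNReal.some_eq_coe']
      · simp [h4, h5, h1, h2, h3, payAt_top, -ENNReal.some_eq_coe']
    · obtain rfl := Player.eq_opp_of_ne hj
      rw [Player.opp_opp] at h2 h3
      rcases h3 with ⟨h4, h3⟩ | ⟨u, h4, ⟨h5, h3⟩ | ⟨h5, h3⟩⟩
      · simp [h4, h1, h2, h3, payAt_top, -ENNReal.some_eq_coe']
      · simp [h4, h5, h1, h2, h3, payAt_top, payAt_coe h3.1, -ENNReal.some_eq_coe']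
      · simp [h4, h5, h1, h2, h3, payAt_top, -ENNReal.some_eq_coe']

lemma isStoppingTime_offerTime (hσ : ∀ j, (σ j).Admissible 𝓕) (hρ : IsStoppingTime 𝓕 ρ)
    (j : Player) : IsStoppingTime 𝓕 (offerTime σ k h ρ j) :=
  (hσ j).propose_stopping k h ρ hρ

lemma le_offerTime (hσ : ∀ j, (σ j).Admissible 𝓕) (j : Player) : ρ ≤ offerTime σ k h ρ j := by
  intro ω
  rcases eq_or_ne (ρ ω) ⊤ with hρ | hρ
  · rw [offerTime_top hρ]; exact le_top
  · obtain ⟨t, ht⟩ := WithTop.ne_top_iff_exists.1 hρ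
    rw [offerTime_coe ht.symm, ← ht]
    exact (hσ j).le_propose k h t ω

lemma measurableSet_ne_top (hρ : IsStoppingTime 𝓕 ρ) :
    MeasurableSet[hρ.measurableSpace] {ω | ρ ω ≠ ⊤} :=
  (hρ.measurable (measurableSet_singleton ⊤)).compl

/-- With a shared right to double, whose offer counts is decided by comparing the two intended
times: weakly for the player with priority, strictly for the other. Either comparison is known at
the time of the respective player's own intended offer. -/
lemma measurableSet_offerEvent (hσ : ∀ j, (σ j).Admissible 𝓕) (hρ : IsStoppingTime 𝓕 ρ)
    (j : Player) :
    MeasurableSet[(isStoppingTime_offerTime (k := k) (h := h) hσ hρ j).measurableSpace]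
      (offerEvent first σ k h ρ j) := by
  have hT := fun j => isStoppingTime_offerTime (k := k) (h := h) hσ hρ j
  have hfin : MeasurableSet[(hT j).measurableSpace] {ω | ρ ω ≠ ⊤} :=
    hρ.measurableSpace_mono (hT j) (le_offerTime hσ j) _ (measurableSet_ne_top hρ)
  have hex : ∀ ω, (∃ t : ℝ≥0, ρ ω = t) ↔ ρ ω ≠ ⊤ := fun ω => by
    rw [WithTop.ne_top_iff_exists]
    exact exists_congr fun t => eq_comm
  cases h with
  | some i =>
    by_cases hij : i = j
    · convert hfin using 1
      ext ω
      simp only [offerEvent, proposer, hij, and_true, Set.mem_ofPred_eq]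
      exact hex ω
    · convert! @MeasurableSet.empty _ (hT j).measurableSpace using 1
      ext ω
      simp [offerEvent, proposer, hij]
  | none =>
    by_cases hj : j = first
    · subst hj
      convert! hfin.inter ((hT j).measurableSet_le_stopping_time (hT j.opp)) using 1
      ext ω
      simp only [offerEvent, proposer, Set.mem_ofPred_eq, Set.mem_inter_iff, ← hex]
      constructor
      · rintro ⟨t, ht, hp⟩
        refine ⟨⟨t, ht⟩, ?_⟩
        rw [offerTime_coe ht, offerTime_coe ht]
        by_contra hn
        rw [if_neg hn] at hp
        exact Player.opp_ne _ hp
      · rintro ⟨⟨t, ht⟩, hle⟩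
        rw [offerTime_coe ht, offerTime_coe ht] at hle
        exact ⟨t, ht, if_pos hle⟩
    · obtain rfl := Player.eq_opp_of_ne hj
      convert! hfin.inter ((hT first).measurableSet_stopping_time_le (hT first.opp)).compl using 1
      ext ω
      simp only [offerEvent, proposer, Set.mem_ofPred_eq, Set.mem_inter_iff, ← hex,
        Set.mem_compl_iff]
      constructor
      · rintro ⟨t, ht, hp⟩
        refine ⟨⟨t, ht⟩, ?_⟩
        rw [offerTime_coe ht, offerTime_coe ht]
        intro hn
        rw [if_pos hn] at hp
        exact hj hp.symm
      · rintro ⟨⟨t, ht⟩, hle⟩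
        rw [offerTime_coe ht, offerTime_coe ht] at hle
        exact ⟨t, ht, if_neg hle⟩

lemma isStoppingTime_acceptTime (hσ : ∀ j, (σ j).Admissible 𝓕) (hρ : IsStoppingTime 𝓕 ρ)
    (j : Player) : IsStoppingTime 𝓕 (acceptTime first σ k h ρ j) := by
  have hT := isStoppingTime_offerTime (k := k) (h := h) hσ hρ j
  exact isStoppingTime_restrictTime hT hT ((measurableSet_offerEvent hσ hρ j).inter
    ((hσ j.opp).accept_measurable k h _ hT)) fun _ _ => le_rfl

lemma isStoppingTime_declineTime (hσ : ∀ j, (σ j).Admissible 𝓕) (hρ : IsStoppingTime 𝓕 ρ)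
    (j : Player) : IsStoppingTime 𝓕 (declineTime first σ k h ρ j) := by
  have hT := isStoppingTime_offerTime (k := k) (h := h) hσ hρ j
  exact isStoppingTime_restrictTime hT hT ((measurableSet_offerEvent hσ hρ j).inter
    ((hσ j.opp).accept_measurable k h _ hT).compl) fun _ _ => le_rfl

lemma measurableSet_endEvent (hσ : ∀ j, (σ j).Admissible 𝓕) (hρ : IsStoppingTime 𝓕 ρ) :
    MeasurableSet (endEvent first σ k h ρ) := by
  simp only [endEvent, forall_player_iff Player.A]
  have ha := fun j => (isStoppingTime_acceptTime (first := first) (k := k) (h := h)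
    hσ hρ j).measurableSet_eq_top
  have hd := fun j => (isStoppingTime_declineTime (first := first) (k := k) (h := h)
    hσ hρ j).measurableSet_eq_top
  exact hρ.measurableSet_eq_top.compl.inter (((ha _).inter (hd _)).inter ((ha _).inter (hd _)))

/-- The player whose offer counts is the one who intends to double first. -/
lemma propose_proposer_le (first : Player) (σ : Player → Strategy Ω) (k : ℕ) (t : ℝ≥0) (ω : Ω)
    {i : Player} (hi : h ≠ some i.opp) :
    (σ (proposer first σ k h t ω)).propose k h t ω ≤ (σ i).propose k h t ω := by
  cases h with
  | some j =>
    have : j = i := by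
      by_contra hj
      exact hi (by rw [Player.eq_opp_of_ne hj])
    subst this
    exact le_rfl
  | none =>
    simp only [proposer]
    by_cases hi' : i = first
    · subst hi'
      split_ifs with hle
      · exact le_rfl
      · exact (not_le.1 hle).le
    · obtain rfl := Player.eq_opp_of_ne hi'
      split_ifs with hle
      · exact hle
      · exact le_rfl

end Stage

/-! ### Expected outcome and integrability of payoffs. -/

lemma outcome_eq (hB : IsBrownianMotion 𝓕 B P) {p : ℝ} (hp : p ∈ Set.Icc (0 : ℝ) 1) (ω : Ω) :
    outcome B p ω =
      (won B p .A).indicator (1 : Ω → ℝ) ω - (won B p .B).indicator (1 : Ω → ℝ) ω := by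
  classical
  by_cases hA : ω ∈ won B p .A
  · have hn : ω ∉ won B p .B := Set.disjoint_left.1 (disjoint_won hB hp .A) hA
    rw [Set.indicator_of_mem hA, Set.indicator_of_notMem hn, outcome,
      if_pos (show ∃ t, state B p t ω = 1 from hA)]
    simp
  · rw [outcome, if_neg (show ¬∃ t, state B p t ω = 1 from hA), Set.indicator_of_notMem hA]
    by_cases hn : ω ∈ won B p .B
    · rw [Set.indicator_of_mem hn]
      rw [won_B] at hn
      rw [if_pos (show ∃ t, state B p t ω = 0 from hn)]
      simp
    · rw [Set.indicator_of_notMem hn]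
      rw [won_B] at hn
      rw [if_neg (show ¬∃ t, state B p t ω = 0 from hn), sub_zero]

lemma sign_mul_outcome (hB : IsBrownianMotion 𝓕 B P) {p : ℝ} (hp : p ∈ Set.Icc (0 : ℝ) 1)
    (i : Player) (ω : Ω) :
    i.sign * outcome B p ω =
      (won B p i).indicator (1 : Ω → ℝ) ω - (won B p i.opp).indicator (1 : Ω → ℝ) ω := by
  rw [outcome_eq hB hp]
  cases i
  · simp [Player.sign, Player.opp]
  · simp [Player.sign, Player.opp]

lemma integrable_outcome [IsProbabilityMeasure P] (hB : IsBrownianMotion 𝓕 B P) {p : ℝ}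
    (hp : p ∈ Set.Icc (0 : ℝ) 1) : Integrable (outcome B p) P := by
  have : outcome B p = fun ω =>
      (won B p .A).indicator (1 : Ω → ℝ) ω - (won B p .B).indicator (1 : Ω → ℝ) ω :=
    funext (outcome_eq hB hp)
  rw [this]
  exact ((integrable_const (1 : ℝ)).indicator (measurableSet_won hB hp .A)).sub
    ((integrable_const (1 : ℝ)).indicator (measurableSet_won hB hp .B))

lemma integral_outcome [IsProbabilityMeasure P] (hB : IsBrownianMotion 𝓕 B P) {p : ℝ}
    (hp : p ∈ Set.Icc (0 : ℝ) 1) : ∫ ω, outcome B p ω ∂P = 2 * p - 1 := by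
  rw [integral_congr_ae (ae_of_all _ (outcome_eq hB hp))]
  have hW : ∀ i, Integrable ((won B p i).indicator (1 : Ω → ℝ)) P := fun i =>
    (integrable_const (1 : ℝ)).indicator (measurableSet_won hB hp i)
  rw [integral_sub (hW .A) (hW .B), integral_indicator_one (measurableSet_won hB hp .A),
    integral_indicator_one (measurableSet_won hB hp .B), ← evaluation_eq_won, ← evaluation_eq_won,
    evaluation_eq hB hp, evaluation_eq hB hp]
  simp only [Player.own]
  ring

lemma integrable_payAt [IsProbabilityMeasure P] (hB : IsBrownianMotion 𝓕 B P) {p : ℝ}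
    (hp : p ∈ Set.Icc (0 : ℝ) 1) (x y : ℝ) (first : Player) {σ : Player → Strategy Ω}
    (hσ : ∀ j, (σ j).Admissible 𝓕) (k : ℕ) :
    ∀ (h : Option Player) {ρ : Ω → WithTop ℝ≥0}, IsStoppingTime 𝓕 ρ →
      Integrable (payAt x y B p first σ k h ρ) P := by
  induction k with
  | zero =>
    intro h ρ hρ
    rw [funext payAt_zero]
    exact (integrable_outcome hB hp).indicator hρ.measurableSet_eq_top.compl
  | succ k ih =>
    intro h ρ hρ
    rw [funext (payAt_succ Player.A)]
    have hd := fun j => (isStoppingTime_declineTime (first := first) (k := k + 1) (h := h)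
      hσ hρ j).measurableSet_eq_top.compl
    exact (((integrable_outcome hB hp).indicator (measurableSet_endEvent hσ hρ)).add
      (((ih _ (isStoppingTime_acceptTime hσ hρ _)).const_mul y).add
        ((integrable_const _).indicator (hd _)))).add
      (((ih _ (isStoppingTime_acceptTime hσ hρ _)).const_mul y).add
        ((integrable_const _).indicator (hd _)))

/-! ### Affine values and the conditions for a guarantee. -/

/-- The affine function with the value `a` at `1` and `b` at `0`. -/
def affineValue (a b q : ℝ) : ℝ := a * q + b * (1 - q)

lemma affineValue_eq (a b q : ℝ) : affineValue a b q = (a - b) * q + b := by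
  rw [affineValue]; ring

lemma mul_affineValue (y a b q : ℝ) : y * affineValue a b q = affineValue (y * a) (y * b) q := by
  simp only [affineValue]; ring

lemma affineValue_const (c q : ℝ) : affineValue c c q = c := by
  simp only [affineValue]; ring

lemma integrable_own_state [IsProbabilityMeasure P] (hB : IsBrownianMotion 𝓕 B P) {p : ℝ}
    (hp : p ∈ Set.Icc (0 : ℝ) 1) (i : Player) {T : Ω → WithTop ℝ≥0} (hT : IsStoppingTime 𝓕 T) :
    Integrable (fun ω => i.own (state B p (T ω).untopA ω)) P :=
  Integrable.of_bound (i.continuous_own.measurable.comp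
    ((measurable_state_stopped hB hp hT).mono hT.measurableSpace_le le_rfl)).aestronglyMeasurable
    1 (ae_of_all _ fun ω => by
      have := i.own_mem_Icc (state_mem_Icc hB hp (T ω).untopA ω)
      rw [Real.norm_eq_abs, abs_of_nonneg this.1]; exact this.2)

lemma setIntegral_affineValue [IsProbabilityMeasure P] (hB : IsBrownianMotion 𝓕 B P) {p : ℝ}
    (hp : p ∈ Set.Icc (0 : ℝ) 1) (i : Player) {T : Ω → WithTop ℝ≥0} (hT : IsStoppingTime 𝓕 T)
    (a b : ℝ) :
    ∫ ω in {ω | T ω ≠ ⊤}, affineValue a b (i.own (state B p (T ω).untopA ω)) ∂P =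
      ∫ ω in {ω | T ω ≠ ⊤}, affineValue a b ((won B p i).indicator 1 ω) ∂P := by
  have hY := integrable_own_state hB hp i hT
  have hW : Integrable ((won B p i).indicator (1 : Ω → ℝ)) P :=
    (integrable_const (1 : ℝ)).indicator (measurableSet_won hB hp i)
  simp only [affineValue_eq]
  rw [integral_add (hY.integrableOn.const_mul _) (integrable_const _),
    integral_add (hW.integrableOn.const_mul _) (integrable_const _), integral_const_mul,
    integral_const_mul, setIntegral_own_state hB hp i hT]

lemma integrable_affineValue [IsProbabilityMeasure P] (hB : IsBrownianMotion 𝓕 B P) {p : ℝ}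
    (hp : p ∈ Set.Icc (0 : ℝ) 1) (i : Player) (a b : ℝ) :
    Integrable (fun ω => affineValue a b ((won B p i).indicator 1 ω)) P := by
  have hW : Integrable ((won B p i).indicator (1 : Ω → ℝ)) P :=
    (integrable_const (1 : ℝ)).indicator (measurableSet_won hB hp i)
  simp only [affineValue_eq]
  exact (hW.const_mul _).add (integrable_const _)

/-- Affine functions of the state can be compared at a stopping time. -/
lemma setIntegral_affineValue_mono [IsProbabilityMeasure P] (hB : IsBrownianMotion 𝓕 B P) {p : ℝ}
    (hp : p ∈ Set.Icc (0 : ℝ) 1) (i : Player) {T : Ω → WithTop ℝ≥0} (hT : IsStoppingTime 𝓕 T)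
    {a b a' b' : ℝ}
    (hle : ∀ ω (u : ℝ≥0), T ω = u → affineValue a b (i.own (state B p u ω)) ≤
      affineValue a' b' (i.own (state B p u ω))) :
    ∫ ω in {ω | T ω ≠ ⊤}, affineValue a b ((won B p i).indicator 1 ω) ∂P ≤
      ∫ ω in {ω | T ω ≠ ⊤}, affineValue a' b' ((won B p i).indicator 1 ω) ∂P := by
  have hi : ∀ a b, Integrable (fun ω => affineValue a b (i.own (state B p (T ω).untopA ω))) P := by
    intro a b
    have hY := integrable_own_state hB hp i hT
    simp only [affineValue_eq]
    exact (hY.const_mul _).add (integrable_const _)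
  -- Optional stopping replaces the final result by the state at `T`, so the inequality is needed
  -- only at states that occur at `T`.
  rw [← setIntegral_affineValue hB hp i hT, ← setIntegral_affineValue hB hp i hT]
  refine setIntegral_mono_on (hi a b).integrableOn (hi a' b').integrableOn
    hT.measurableSet_eq_top.compl fun ω hω => ?_
  obtain ⟨u, hu⟩ := WithTop.ne_top_iff_exists.1 hω
  have : (T ω).untopA = u := by rw [← hu]; rfl
  rw [this]
  exact hle ω u hu.symm

/-- Sufficient conditions for the rule to double at the own evaluations in `D` and to accept at
those in `R` to guarantee the player `i` the payoff `affineValue (a k h) (b k h) q` from every own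
evaluation `q` and in every stage `(k, h)`. -/
structure Guarantees (x y : ℝ) (i : Player) (D : Set ℝ) (R : ℕ → Bool → Set ℝ)
    (a b : ℕ → Option Player → ℝ) : Prop where
  zero_win : ∀ h, a 0 h ≤ 1
  zero_loss : ∀ h, b 0 h ≤ -1
  offer_accepted : ∀ k h, h ≠ some i.opp → ∀ q ∈ D,
    affineValue (a (k + 1) h) (b (k + 1) h) q ≤
      y * affineValue (a k (some i.opp)) (b k (some i.opp)) q
  offer_declined : ∀ k h, h ≠ some i.opp → ∀ q ∈ D,
    affineValue (a (k + 1) h) (b (k + 1) h) q ≤ x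
  accept : ∀ k h, h ≠ some i → ∀ q ∈ Set.Icc (0 : ℝ) 1, q ∈ R (k + 1) h.isNone →
    affineValue (a (k + 1) h) (b (k + 1) h) q ≤ y * affineValue (a k (some i)) (b k (some i)) q
  decline : ∀ k h, h ≠ some i → ∀ q ∈ Set.Icc (0 : ℝ) 1, q ∉ R (k + 1) h.isNone →
    affineValue (a (k + 1) h) (b (k + 1) h) q ≤ -x
  -- If `i` may double and `1 ∈ D`, a walk frozen at `1` triggers an offer, so a win without a
  -- further double cannot occur and nothing is required; likewise for losses and `0`.
  win : ∀ k h, (h ≠ some i.opp → (1 : ℝ) ∉ D) → a (k + 1) h ≤ 1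
  loss : ∀ k h, (h ≠ some i.opp → (0 : ℝ) ∉ D) → b (k + 1) h ≤ -1

lemma mem_of_hittingAfter_eq_coe {f : ℝ≥0 → Ω → ℝ} {D : Set ℝ} (hD : IsClosed D) {s u : ℝ≥0}
    {ω : Ω} (hf : Continuous fun t => f t ω) (h : hittingAfter f D s ω = u) : f u ω ∈ D := by
  classical
  rw [hittingAfter_def] at h
  dsimp only at h
  split_ifs at h with hex
  · rw [WithTop.coe_inj] at h
    have hc : IsClosed {i | s ≤ i ∧ f i ω ∈ D} := isClosed_Ici.inter (hD.preimage hf)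
    have := hc.csInf_mem hex (OrderBot.bddBelow _)
    rw [h] at this
    exact this.2
  · exact absurd h.symm WithTop.coe_ne_top

lemma continuous_own_state (hB : IsBrownianMotion 𝓕 B P) {p : ℝ}
    (hp : p ∈ Set.Icc (0 : ℝ) 1) (i : Player) (ω : Ω) : Continuous fun t => i.own (state B p t ω) :=
  i.continuous_own.comp (continuous_state hB hp ω)

lemma integral_add_pairs {f₁ f₂ f₃ f₄ f₅ : Ω → ℝ} (h₁ : Integrable f₁ P) (h₂ : Integrable f₂ P)
    (h₃ : Integrable f₃ P) (h₄ : Integrable f₄ P) (h₅ : Integrable f₅ P) :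
    ∫ ω, f₁ ω + (f₂ ω + f₃ ω) + (f₄ ω + f₅ ω) ∂P =
      ∫ ω, f₁ ω ∂P + (∫ ω, f₂ ω ∂P + ∫ ω, f₃ ω ∂P) + (∫ ω, f₄ ω ∂P + ∫ ω, f₅ ω ∂P) := by
  have e := integral_add (h₁.add (h₂.add h₃)) (h₄.add h₅)
  rw [integral_add' h₁ (h₂.add h₃), integral_add' h₂ h₃, integral_add' h₄ h₅] at e
  exact e

/-! ### The guarantee theorem and admissibility of the rules. -/

section Rule

variable [IsProbabilityMeasure P] {p : ℝ} {D : Set ℝ} {R : ℕ → Bool → Set ℝ} {i : Player}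

lemma doublingRule_propose (hB : IsBrownianMotion 𝓕 B P) (hp : p ∈ Set.Icc (0 : ℝ) 1) (k : ℕ)
    (h : Option Player) (t : ℝ≥0) :
    (doublingRule P B p D R i).propose k h t =
      hittingAfter (fun u ω => i.own (state B p u ω)) D t := by
  have : (fun u ω => evaluation P B i (state B p u ω)) = fun u ω => i.own (state B p u ω) := by
    funext u ω
    exact evaluation_eq hB (state_mem_Icc hB hp u ω) i
  simp only [doublingRule, this]

lemma mem_doublingRule_accept (hB : IsBrownianMotion 𝓕 B P) (hp : p ∈ Set.Icc (0 : ℝ) 1) (k : ℕ)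
    (h : Option Player) (t : ℝ≥0) (ω : Ω) :
    ω ∈ (doublingRule P B p D R i).accept k h t ↔ i.own (state B p t ω) ∈ R k h.isNone := by
  simp only [doublingRule, Set.mem_ofPred_eq]
  rw [evaluation_eq hB (state_mem_Icc hB hp t ω) i]

/-- If a stage in which `i` may double ends without a double, then the walk never meets `D`. -/
lemma notMem_of_mem_endEvent (hB : IsBrownianMotion 𝓕 B P) (hp : p ∈ Set.Icc (0 : ℝ) 1)
    {σ : Player → Strategy Ω} (hσi : σ i = doublingRule P B p D R i) {first : Player} {k : ℕ}
    {h : Option Player} (hh : h ≠ some i.opp) {ρ : Ω → WithTop ℝ≥0} {ω : Ω}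
    (hω : ω ∈ endEvent first σ k h ρ) :
    ∃ t : ℝ≥0, ∀ u ≥ t, i.own (state B p u ω) ∉ D := by
  rcases stage_cases first σ k h ρ ω with ⟨h1, -⟩ | ⟨t, j, h1, hj, -, h3⟩
  · exact absurd h1 hω.1
  · refine ⟨t, ?_⟩
    have hend := hω.2 j
    rcases h3 with ⟨h4, -⟩ | ⟨u, -, ⟨-, h5, -⟩ | ⟨-, -, h5⟩⟩
    · have hle := propose_proposer_le first σ k t ω hh
      rw [hj, h4, top_le_iff, hσi, doublingRule_propose hB hp, hittingAfter_eq_top_iff] at hle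
      exact hle
    · exact absurd (h5.symm.trans hend.1) WithTop.coe_ne_top
    · exact absurd (h5.symm.trans hend.2) WithTop.coe_ne_top

/-- Induction on `k`, with an arbitrary starting time `ρ` because the next stage begins at the
random time of an accepted double. The event that the stage begins is split into five courses, and
the integral of the candidate value is bounded on each: by `win` and `loss` if no double occurs, by
the constant `x` or `-x` after a declined offer, and after an accepted one by `y` times the
induction hypothesis. Optional stopping localizes the comparisons to the states at which offers
occur. -/
theorem Guarantees.setIntegral_le {x y : ℝ} (hy : 0 < y) (hB : IsBrownianMotion 𝓕 B P)
    (hp : p ∈ Set.Icc (0 : ℝ) 1) (hD : IsClosed D) {a b : ℕ → Option Player → ℝ}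
    (hG : Guarantees x y i D R a b) {σ : Player → Strategy Ω}
    (hσ : ∀ j, (σ j).Admissible 𝓕) (hσi : σ i = doublingRule P B p D R i) (first : Player)
    (k : ℕ) : ∀ (h : Option Player) {ρ : Ω → WithTop ℝ≥0}, IsStoppingTime 𝓕 ρ →
      ∫ ω in {ω | ρ ω ≠ ⊤}, affineValue (a k h) (b k h) ((won B p i).indicator 1 ω) ∂P ≤
        ∫ ω, i.sign * payAt x y B p first σ k h ρ ω ∂P := by
  have hfinal : ∀ ω, ω ∈ won B p i ∨ ω ∈ won B p i.opp → ∀ a b : ℝ,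
      (ω ∈ won B p i → a ≤ 1) → (ω ∈ won B p i.opp → b ≤ -1) →
      affineValue a b ((won B p i).indicator 1 ω) ≤ i.sign * outcome B p ω := by
    intro ω hω a b ha hb
    rw [sign_mul_outcome hB hp]
    rcases hω with hω | hω
    · have hn : ω ∉ won B p i.opp := Set.disjoint_left.1 (disjoint_won hB hp i) hω
      simpa [affineValue, hω, hn] using ha hω
    · have hn : ω ∉ won B p i := Set.disjoint_right.1 (disjoint_won hB hp i) hω
      simpa [affineValue, hω, hn] using hb hω
  have hiV := integrable_affineValue hB hp i
  have hiO : Integrable (fun ω => i.sign * outcome B p ω) P :=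
    (integrable_outcome hB hp).const_mul _
  induction k with
  | zero =>
    intro h ρ hρ
    have hm : MeasurableSet {ω | ρ ω ≠ ⊤} := hρ.measurableSet_eq_top.compl
    have : ∀ ω, i.sign * payAt x y B p first σ 0 h ρ ω =
        {ω | ρ ω ≠ ⊤}.indicator (fun ω => i.sign * outcome B p ω) ω := fun ω => by
      rw [payAt_zero, ← Set.indicator_const_mul]
    simp only [this]
    rw [integral_indicator hm]
    refine setIntegral_mono_ae (hiV _ _).integrableOn hiO.integrableOn ?_
    filter_upwards [ae_won_or hB hp i] with ω hω
    exact hfinal ω hω _ _ (fun _ => hG.zero_win h) fun _ => hG.zero_loss h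
  | succ k ih =>
    intro h ρ hρ
    have hTa := fun j => isStoppingTime_acceptTime (first := first) (k := k + 1) (h := h) hσ hρ j
    have hTd := fun j => isStoppingTime_declineTime (first := first) (k := k + 1) (h := h) hσ hρ j
    have hma : ∀ j, MeasurableSet {ω | acceptTime first σ (k + 1) h ρ j ω ≠ ⊤} :=
      fun j => (hTa j).measurableSet_eq_top.compl
    have hmd : ∀ j, MeasurableSet {ω | declineTime first σ (k + 1) h ρ j ω ≠ ⊤} :=
      fun j => (hTd j).measurableSet_eq_top.compl
    have hE := measurableSet_endEvent (first := first) (k := k + 1) (h := h) hσ hρ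
    set f : Ω → ℝ := fun ω =>
      affineValue (a (k + 1) h) (b (k + 1) h) ((won B p i).indicator 1 ω) with hf
    have hfi : Integrable f P := hiV _ _
    have hpay : ∀ ω, i.sign * payAt x y B p first σ (k + 1) h ρ ω =
        (endEvent first σ (k + 1) h ρ).indicator (fun ω => i.sign * outcome B p ω) ω +
        (y * (i.sign * payAt x y B p first σ k (some i.opp)
            (acceptTime first σ (k + 1) h ρ i) ω) +
          {ω | declineTime first σ (k + 1) h ρ i ω ≠ ⊤}.indicator (fun _ => x) ω) +
        (y * (i.sign * payAt x y B p first σ k (some i)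
            (acceptTime first σ (k + 1) h ρ i.opp) ω) +
          {ω | declineTime first σ (k + 1) h ρ i.opp ω ≠ ⊤}.indicator (fun _ => -x) ω) := by
      intro ω
      classical
      have hs : i.sign = 1 ∨ i.sign = -1 := by cases i <;> simp [Player.sign]
      rw [payAt_succ i]
      simp only [Set.indicator_apply, Player.sign_opp]
      rcases hs with hs | hs <;> simp only [hs] <;> split_ifs <;> ring
    have hip := fun h' j => (integrable_payAt hB hp x y first hσ k h' (hTa j)).const_mul i.sign
    have hind := fun (j : Player) (c : ℝ) => (integrable_const (μ := P) c).indicator (hmd j)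
    simp only [hpay]
    have hmρ : MeasurableSet {ω | ρ ω ≠ ⊤} := hρ.measurableSet_eq_top.compl
    rw [← integral_indicator hmρ,
      integral_congr_ae (ae_of_all P (indicator_ne_top_eq first σ (k + 1) h ρ i f))]
    rw [integral_add_pairs (hfi.indicator hE) (hfi.indicator (hma i)) (hfi.indicator (hmd i))
        (hfi.indicator (hma i.opp)) (hfi.indicator (hmd i.opp)),
      integral_add_pairs (hiO.indicator hE) ((hip _ i).const_mul y) (hind i x)
        ((hip _ i.opp).const_mul y) (hind i.opp (-x)),
      integral_const_mul y, integral_const_mul y, integral_indicator hE, integral_indicator hE,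
      integral_indicator (hma i), integral_indicator (hma i.opp), integral_indicator (hmd i),
      integral_indicator (hmd i), integral_indicator (hmd i.opp), integral_indicator (hmd i.opp)]
    have hmem := fun u ω => i.own_mem_Icc (state_mem_Icc hB hp u ω)
    -- By closedness of `D` and path continuity, the hitting time is attained in `D`.
    have hoffer : ∀ (ω : Ω) (u : ℝ≥0), ω ∈ offerEvent first σ (k + 1) h ρ i →
        offerTime σ (k + 1) h ρ i ω = u → i.own (state B p u ω) ∈ D := by
      rintro ω u ⟨t, ht, -⟩ hu
      rw [offerTime_coe ht, hσi, doublingRule_propose hB hp] at hu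
      exact mem_of_hittingAfter_eq_coe (f := fun u ω => i.own (state B p u ω)) hD
        (continuous_own_state hB hp i ω) hu
    have hyint : ∀ (a' b' : ℝ) (S : Set Ω),
        ∫ ω in S, affineValue (y * a') (y * b') ((won B p i).indicator 1 ω) ∂P =
          y * ∫ ω in S, affineValue a' b' ((won B p i).indicator 1 ω) ∂P := by
      intro a' b' S
      rw [← integral_const_mul]
      simp only [mul_affineValue]
    have h1 : ∫ ω in endEvent first σ (k + 1) h ρ, f ω ∂P ≤
        ∫ ω in endEvent first σ (k + 1) h ρ, i.sign * outcome B p ω ∂P := by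
      refine integral_mono_ae hfi.integrableOn hiO.integrableOn ?_
      filter_upwards [ae_restrict_of_ae (ae_won_or hB hp i), ae_restrict_mem hE] with ω hω hωE
      refine hfinal ω hω _ _ (fun hw => hG.win k h fun hh h1D => ?_)
        fun hw => hG.loss k h fun hh h0D => ?_
      -- The won walk stays at own evaluation `1`; were `1` in `D`, it would have been doubled.
      · obtain ⟨t, ht⟩ := notMem_of_mem_endEvent hB hp hσi hh hωE
        obtain ⟨s, hs⟩ := hw
        refine ht (max t s) (le_max_left _ _) ?_
        rwa [own_absorbing hB hp i (Or.inr rfl) (le_max_right t s) hs]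
      · obtain ⟨t, ht⟩ := notMem_of_mem_endEvent hB hp hσi hh hωE
        obtain ⟨s, hs⟩ := hw
        rw [Player.own_opp] at hs
        refine ht (max t s) (le_max_left _ _) ?_
        rwa [own_absorbing hB hp i (Or.inl rfl) (le_max_right t s) (by linarith)]
    have h2 : ∫ ω in {ω | acceptTime first σ (k + 1) h ρ i ω ≠ ⊤}, f ω ∂P ≤
        y * ∫ ω, i.sign * payAt x y B p first σ k (some i.opp)
          (acceptTime first σ (k + 1) h ρ i) ω ∂P := by
      refine le_trans ?_ (mul_le_mul_of_nonneg_left (ih (some i.opp) (hTa i)) hy.le)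
      rw [← hyint]
      refine setIntegral_affineValue_mono hB hp i (hTa i) fun ω u hu => ?_
      obtain ⟨ho, hu, -⟩ := acceptTime_eq_coe hu
      rw [← mul_affineValue]
      exact hG.offer_accepted k h (ne_some_opp_of_mem_offerEvent ho) _ (hoffer ω u ho hu)
    have h3 : ∫ ω in {ω | declineTime first σ (k + 1) h ρ i ω ≠ ⊤}, f ω ∂P ≤
        ∫ ω in {ω | declineTime first σ (k + 1) h ρ i ω ≠ ⊤}, x ∂P := by
      have := setIntegral_affineValue_mono hB hp i (hTd i) (a := a (k + 1) h) (b := b (k + 1) h)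
        (a' := x) (b' := x) fun ω u hu => by
          obtain ⟨ho, hu, -⟩ := declineTime_eq_coe hu
          rw [affineValue_const]
          exact hG.offer_declined k h (ne_some_opp_of_mem_offerEvent ho) _ (hoffer ω u ho hu)
      simpa only [affineValue_const] using this
    have h4 : ∫ ω in {ω | acceptTime first σ (k + 1) h ρ i.opp ω ≠ ⊤}, f ω ∂P ≤
        y * ∫ ω, i.sign * payAt x y B p first σ k (some i)
          (acceptTime first σ (k + 1) h ρ i.opp) ω ∂P := by
      refine le_trans ?_ (mul_le_mul_of_nonneg_left (ih (some i) (hTa i.opp)) hy.le)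
      rw [← hyint]
      refine setIntegral_affineValue_mono hB hp i (hTa i.opp) fun ω u hu => ?_
      obtain ⟨ho, -, hacc⟩ := acceptTime_eq_coe hu
      have hh := ne_some_opp_of_mem_offerEvent ho
      rw [Player.opp_opp] at hh hacc
      rw [hσi, mem_doublingRule_accept hB hp] at hacc
      rw [← mul_affineValue]
      exact hG.accept k h hh _ (hmem u ω) hacc
    have h5 : ∫ ω in {ω | declineTime first σ (k + 1) h ρ i.opp ω ≠ ⊤}, f ω ∂P ≤
        ∫ ω in {ω | declineTime first σ (k + 1) h ρ i.opp ω ≠ ⊤}, -x ∂P := by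
      have := setIntegral_affineValue_mono hB hp i (hTd i.opp) (a := a (k + 1) h)
        (b := b (k + 1) h) (a' := -x) (b' := -x) fun ω u hu => by
          obtain ⟨ho, -, hacc⟩ := declineTime_eq_coe hu
          have hh := ne_some_opp_of_mem_offerEvent ho
          rw [Player.opp_opp] at hh hacc
          rw [hσi, mem_doublingRule_accept hB hp] at hacc
          rw [affineValue_const]
          exact hG.decline k h hh _ (hmem u ω) hacc
      simpa only [affineValue_const] using this
    linarith

/-- The expected payoff is at least the guaranteed one, whatever the opponent does. -/
theorem Guarantees.le_expectedPayoff {x y : ℝ} (hy : 0 < y) (hB : IsBrownianMotion 𝓕 B P)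
    (hp : p ∈ Set.Icc (0 : ℝ) 1) (hD : IsClosed D) {a b : ℕ → Option Player → ℝ}
    (hG : Guarantees x y i D R a b) {σ : Player → Strategy Ω}
    (hσ : ∀ j, (σ j).Admissible 𝓕) (hσi : σ i = doublingRule P B p D R i) (first : Player)
    (k : ℕ) (h : Option Player) :
    affineValue (a k h) (b k h) (i.own p) ≤ expectedPayoff P x y B p first k h i σ := by
  have hle := hG.setIntegral_le hy hB hp hD hσ hσi first k h (isStoppingTime_const 𝓕 0)
  rw [← setIntegral_affineValue hB hp i (isStoppingTime_const 𝓕 0)] at hle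
  have hs : {ω : Ω | ((0 : ℝ≥0) : WithTop ℝ≥0) ≠ ⊤} = Set.univ := by simp
  have hu : ((0 : ℝ≥0) : WithTop ℝ≥0).untopA = 0 := rfl
  rw [hs, setIntegral_univ, hu] at hle
  simp only [state_zero hB, integral_const, probReal_univ, one_smul] at hle
  exact hle

/-- Both boundary states are absorbing. Hence a boundary point is hit after `s` and by time `t`
exactly if `s ≤ t` and the state at `t` is that point, so a single observation at `t` decides. -/
lemma admissible_doublingRule (hB : IsBrownianMotion 𝓕 B P) (hp : p ∈ Set.Icc (0 : ℝ) 1)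
    (hD : D = ∅ ∨ D = {0} ∨ D = {1}) (hR : ∀ k c, MeasurableSet (R k c)) (i : Player) :
    (doublingRule P B p D R i).Admissible 𝓕 where
  le_propose k h t ω := by
    rw [doublingRule_propose hB hp]
    exact le_hittingAfter ω
  propose_stopping k h ρ hρ := by
    simp only [doublingRule_propose hB hp]
    have hb : D = ∅ ∨ ∃ b : ℝ, (b = 0 ∨ b = 1) ∧ D = {b} := by
      rcases hD with hD | hD | hD
      · exact Or.inl hD
      · exact Or.inr ⟨0, Or.inl rfl, hD⟩
      · exact Or.inr ⟨1, Or.inr rfl, hD⟩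
    rcases hb with rfl | ⟨b, hb, rfl⟩
    · intro t
      have : {ω | WithTop.recTopCoe (C := fun _ => WithTop ℝ≥0) ⊤ (fun t : ℝ≥0 =>
          hittingAfter (fun u ω => i.own (state B p u ω)) ∅ t ω) (ρ ω) ≤ t} = ∅ := by
        ext ω
        simp only [hittingAfter_empty, Set.mem_ofPred_eq, Set.mem_empty_iff_false, iff_false]
        cases ρ ω <;> exact fun hle => WithTop.coe_ne_top (top_le_iff.1 hle)
      rw [this]
      exact @MeasurableSet.empty _ (𝓕 t)
    · intro t
      have hm : MeasurableSet[𝓕 t] {ω | i.own (state B p t ω) = b} :=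
        (i.continuous_own.measurable.comp (measurable_state hB hp t)) (measurableSet_singleton b)
      convert (hρ t).inter hm using 1
      ext ω
      simp only [Set.mem_ofPred_eq, Set.mem_inter_iff]
      cases hρω : ρ ω with
      | top =>
        exact ⟨fun hle => absurd (top_le_iff.1 hle) WithTop.coe_ne_top,
          fun hle => absurd (top_le_iff.1 hle.1) WithTop.coe_ne_top⟩
      | coe s =>
        change hittingAfter (fun u ω => i.own (state B p u ω)) {b} s ω ≤ t ↔ _
        rw [WithTop.coe_le_coe]
        constructor
        · intro hle
          obtain ⟨u, hu⟩ := WithTop.ne_top_iff_exists.1 (ne_top_of_le_ne_top WithTop.coe_ne_top hle)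
          have hmem := mem_of_hittingAfter_eq_coe (f := fun u ω => i.own (state B p u ω))
            isClosed_singleton (continuous_own_state hB hp i ω) hu.symm
          have hsu := le_hittingAfter (u := fun u ω => i.own (state B p u ω)) (s := {b}) (n := s) ω
          rw [← hu, WithTop.coe_le_coe] at hle hsu
          exact ⟨hsu.trans hle, own_absorbing hB hp i hb hle hmem⟩
        · rintro ⟨hst, hbt⟩
          exact hittingAfter_le_of_mem hst hbt
  accept_measurable k h ρ hρ := by
    simp only [mem_doublingRule_accept hB hp]
    convert (measurableSet_ne_top hρ).inter ((i.continuous_own.measurable.comp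
      (measurable_state_stopped hB hp hρ)) (hR k h.isNone)) using 1
    ext ω
    simp only [Set.mem_ofPred_eq, Set.mem_inter_iff, Set.mem_preimage, Function.comp_apply]
    constructor
    · rintro ⟨t, ht, hmem⟩
      rw [ht]
      exact ⟨WithTop.coe_ne_top, hmem⟩
    · rintro ⟨hne, hmem⟩
      obtain ⟨t, ht⟩ := WithTop.ne_top_iff_exists.1 hne
      rw [← ht] at hmem
      exact ⟨t, ht.symm, hmem⟩

end Rule

/-! ### From guarantees to equilibrium, and the candidate values. -/

lemma expectedPayoff_opp (x y p : ℝ) (first : Player) (k : ℕ) (h : Option Player) (i : Player)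
    (σ : Player → Strategy Ω) :
    expectedPayoff P x y B p first k h i.opp σ = -expectedPayoff P x y B p first k h i σ := by
  simp only [expectedPayoff, Player.sign_opp, neg_mul]
  rw [integral_neg]

/-- Rules that guarantee both players payoffs with sum zero are optimal. -/
theorem isOptimalDoubling_of_guarantees [IsProbabilityMeasure P] {x y : ℝ} (hy : 0 < y)
    (hB : IsBrownianMotion 𝓕 B P) {D : Set ℝ} (hD : D = ∅ ∨ D = {0} ∨ D = {1})
    {R : ℕ → Bool → Set ℝ} (hR : ∀ k c, MeasurableSet (R k c))
    {a b : Player → ℕ → Option Player → ℝ} (hab : ∀ i k h, b i k h = -a i.opp k h)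
    (hG : ∀ i, Guarantees x y i D R (a i) (b i)) : IsOptimalDoubling P 𝓕 B x y D := by
  have hDc : IsClosed D := by
    rcases hD with rfl | rfl | rfl
    · exact isClosed_empty
    · exact isClosed_singleton
    · exact isClosed_singleton
  refine ⟨R, hR, fun p hp => ?_⟩
  have hadm := admissible_doublingRule hB hp hD hR
  refine ⟨hadm, fun first k h i τ hτ => ?_⟩
  have h1 := (hG i).le_expectedPayoff hy hB hp hDc hadm rfl first k h
  have h2 := (hG i.opp).le_expectedPayoff hy hB hp hDc
    (σ := Function.update (doublingRule P B p D R) i τ)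
    (fun j => by
      by_cases hj : j = i
      · subst hj; rwa [Function.update_self]
      · rw [Function.update_of_ne hj]; exact hadm j)
    (Function.update_of_ne i.opp_ne _ _) first k h
  -- The opponent's guarantee bounds the deviating player's payoff from above by exactly the amount
  -- that the player's own guarantee secures without deviating.
  rw [expectedPayoff_opp, hab, Player.opp_opp, Player.own_opp] at h2
  rw [hab] at h1
  simp only [affineValue] at h1 h2
  linarith

/-- The value that a won walk has for the player `i`, if with a double available the winner gains
the factor `u` by an own right to double, and `w` by a right to double of the opponent. -/
def winValue (u w : ℝ) (i : Player) (k : ℕ) (h : Option Player) : ℝ :=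
  if k = 0 then 1 else (if h = some i.opp then 1 else u) * (if h = some i then 1 else w)

/-- The value of a lost walk, see `winValue`. -/
def lossValue (u w : ℝ) (i : Player) (k : ℕ) (h : Option Player) : ℝ :=
  -winValue u w i.opp k h

/-- The strategy of a player who never doubles, and accepts a double on the event `S`. -/
def passive (S : Set Ω) : Strategy Ω where
  propose _ _ _ _ := ⊤
  accept _ _ _ := S

lemma admissible_passive {S : Set Ω} (hS : S = Set.univ ∨ S = ∅) :
    (passive S).Admissible 𝓕 where
  le_propose _ _ _ _ := le_top
  propose_stopping k h ρ hρ := by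
    intro t
    have : {ω | WithTop.recTopCoe (C := fun _ => WithTop ℝ≥0) ⊤
        (fun t : ℝ≥0 => (passive S).propose k h t ω) (ρ ω) ≤ t} = ∅ := by
      ext ω
      simp only [passive, Set.mem_ofPred_eq, Set.mem_empty_iff_false, iff_false]
      cases ρ ω <;> exact fun hle => WithTop.coe_ne_top (top_le_iff.1 hle)
    rw [this]
    exact @MeasurableSet.empty _ (𝓕 t)
  accept_measurable k h ρ hρ := by
    rcases hS with rfl | rfl
    · convert measurableSet_ne_top hρ using 1
      ext ω
      simp only [passive, Set.mem_univ, and_true, Set.mem_ofPred_eq]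
      rw [WithTop.ne_top_iff_exists]
      exact exists_congr fun t => eq_comm
    · convert! @MeasurableSet.empty _ hρ.measurableSpace using 1
      ext ω
      simp [passive]

/-! ### Necessary conditions on any optimal doubling set. -/

section Unique

variable [IsProbabilityMeasure P] {x y : ℝ}

/-- In an equilibrium, a player gets the payoff which a strategy can guarantee, whatever the
opponent does. -/
lemma Guarantees.le_of_isOptimalDoubling (hy : 0 < y) (hB : IsBrownianMotion 𝓕 B P)
    {D : Set ℝ} (hD : D = ∅ ∨ D = {0} ∨ D = {1}) {R : ℕ → Bool → Set ℝ}
    (hR : ∀ k c, MeasurableSet (R k c)) {i : Player} {a b : ℕ → Option Player → ℝ}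
    (hG : Guarantees x y i D R a b) {D' : Set ℝ} {R' : ℕ → Bool → Set ℝ} {p : ℝ}
    (hp : p ∈ Set.Icc (0 : ℝ) 1) (hadm : ∀ i, (doublingRule P B p D' R' i).Admissible 𝓕)
    {first : Player} {k : ℕ} {h : Option Player}
    (hopt : ∀ (i : Player) (τ : Strategy Ω), τ.Admissible 𝓕 →
      expectedPayoff P x y B p first k h i (Function.update (doublingRule P B p D' R') i τ) ≤
        expectedPayoff P x y B p first k h i (doublingRule P B p D' R'))
    {τ : Strategy Ω} (hτ : τ.Admissible 𝓕) :
    affineValue (a k h) (b k h) (i.own p) ≤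
      expectedPayoff P x y B p first k h i (Function.update (doublingRule P B p D' R') i.opp τ) := by
  have hDc : IsClosed D := by
    rcases hD with rfl | rfl | rfl
    · exact isClosed_empty
    · exact isClosed_singleton
    · exact isClosed_singleton
  have hadm' := admissible_doublingRule hB hp hD hR i
  have h1 := hG.le_expectedPayoff hy hB hp hDc
    (σ := Function.update (doublingRule P B p D' R') i (doublingRule P B p D R i))
    (fun j => by
      by_cases hj : j = i
      · subst hj; rwa [Function.update_self]
      · rw [Function.update_of_ne hj]; exact hadm j)
    (Function.update_self _ _ _) first k h
  -- The guaranteed value is at most what `i` gets by switching to the guaranteeing rule, hence at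
  -- most the equilibrium payoff; in a zero-sum game the latter is at most what `i` gets when the
  -- opponent deviates to `τ`.
  have h2 := hopt i _ hadm'
  have h3 := hopt i.opp τ hτ
  rw [expectedPayoff_opp, expectedPayoff_opp] at h3
  linarith

/-- Constraints on the evaluations at which doubling is optimal: doubling once must not give away
anything of the guaranteed value, whether the double is accepted or declined, and a decided walk
is doubled unless this does not pay. -/
lemma Guarantees.constraints (hy : 0 < y) (hB : IsBrownianMotion 𝓕 B P)
    {D : Set ℝ} (hD : D = ∅ ∨ D = {0} ∨ D = {1}) {R : ℕ → Bool → Set ℝ}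
    (hR : ∀ k c, MeasurableSet (R k c)) {a b : ℕ → Option Player → ℝ}
    (hG : Guarantees x y .A D R a b) {D' : Set ℝ} (hopt : IsOptimalDoubling P 𝓕 B x y D') :
    (∀ q ∈ Set.Icc (0 : ℝ) 1, q ∈ D' →
      affineValue (a 1 (some .A)) (b 1 (some .A)) q ≤ y * (2 * q - 1) ∧
      affineValue (a 1 (some .A)) (b 1 (some .A)) q ≤ x) ∧
    ((0 : ℝ) ∉ D' → b 1 (some .A) ≤ -1) ∧ ((1 : ℝ) ∉ D' → a 1 (some .A) ≤ 1) := by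
  obtain ⟨R', -, hopt⟩ := hopt
  -- Test position: one double, owned by Player A, against a passive opponent. An accepted double
  -- leaves none available, so the walk then decides at stake `y`.
  have key : ∀ {p : ℝ}, p ∈ Set.Icc (0 : ℝ) 1 → ∀ {S : Set Ω}, (S = Set.univ ∨ S = ∅) →
      affineValue (a 1 (some .A)) (b 1 (some .A)) p ≤
        expectedPayoff P x y B p .A 1 (some .A) .A
          (Function.update (doublingRule P B p D' R') .B (passive S)) := by
    intro p hp S hS
    obtain ⟨hadm, hopt⟩ := hopt p hp
    exact hG.le_of_isOptimalDoubling hy hB hD hR hp hadm (hopt .A 1 (some .A))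
      (admissible_passive hS)
  have hA : ∀ (p : ℝ) (S : Set Ω), Function.update (doublingRule P B p D' R') .B (passive S) .A =
      doublingRule P B p D' R' .A := fun p S => Function.update_of_ne (by simp) _ _
  have hpayTop : ∀ (p : ℝ) (S : Set Ω) (ω : Ω),
      (doublingRule P B p D' R' .A).propose 1 (some .A) 0 ω = ⊤ →
      payoff x y B p .A (Function.update (doublingRule P B p D' R') .B (passive S)) 1 (some .A) 0 ω
        = outcome B p ω := by
    intro p S ω ht
    simp only [payoff, proposer, hA, zero_add, ht]
    rfl
  have hpay : ∀ (p : ℝ) (S : Set Ω) (ω : Ω),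
      (doublingRule P B p D' R' .A).propose 1 (some .A) 0 ω = ((0 : ℝ≥0) : WithTop ℝ≥0) →
      payoff x y B p .A (Function.update (doublingRule P B p D' R') .B (passive S)) 1 (some .A) 0 ω
        = by classical exact if ω ∈ S then y * outcome B p ω else x := by
    intro p S ω ht
    have hOpp : Function.update (doublingRule P B p D' R') .B (passive S) (Player.opp .A) =
        passive S := Function.update_self _ _ _
    simp only [payoff, proposer, hA, zero_add, ht]
    rw [WithTop.recTopCoe_coe]
    have hmem : ω ∈ (Function.update (doublingRule P B p D' R') .B (passive S)
        (Player.opp .A)).accept (0 + 1) (some .A) 0 ↔ ω ∈ S := by rw [hOpp]; rfl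
    by_cases hS : ω ∈ S
    · exact (if_pos (hmem.2 hS)).trans (if_pos hS).symm
    · refine (if_neg fun hc => hS (hmem.1 hc)).trans ?_
      rw [if_neg hS, Player.sign, one_mul]
  have hdouble : ∀ p ∈ Set.Icc (0 : ℝ) 1, p ∈ D' → ∀ ω,
      (doublingRule P B p D' R' .A).propose 1 (some .A) 0 ω = ((0 : ℝ≥0) : WithTop ℝ≥0) := by
    intro p hp hpD ω
    rw [doublingRule_propose hB hp]
    refine le_antisymm (hittingAfter_le_of_mem le_rfl ?_) (le_hittingAfter ω)
    rwa [state_zero hB]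
  -- A walk started at a boundary point outside `D'` remains there, so the rule never offers.
  have hnever : ∀ p : ℝ, (p = 0 ∨ p = 1) → p ∉ D' → ∀ ω,
      (doublingRule P B p D' R' .A).propose 1 (some .A) 0 ω = ⊤ := by
    intro p hp hpD ω
    have hpI : p ∈ Set.Icc (0 : ℝ) 1 := by rcases hp with rfl | rfl <;> simp
    rw [doublingRule_propose hB hpI, hittingAfter_eq_top_iff]
    intro t _
    rwa [own_absorbing hB hpI .A hp (zero_le : (0 : ℝ≥0) ≤ t) (state_zero hB p ω)]
  refine ⟨fun q hq hqD => ⟨?_, ?_⟩, fun h0 => ?_, fun h1 => ?_⟩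
  · have := key hq (S := Set.univ) (Or.inl rfl)
    rw [expectedPayoff, integral_congr_ae (ae_of_all _ fun ω => by
      rw [hpay q Set.univ ω (hdouble q hq hqD ω)])] at this
    simpa [Player.sign, integral_const_mul, integral_outcome hB hq] using this
  · have := key hq (S := ∅) (Or.inr rfl)
    rw [expectedPayoff, integral_congr_ae (ae_of_all _ fun ω => by
      rw [hpay q ∅ ω (hdouble q hq hqD ω)])] at this
    simpa [Player.sign] using this
  · have hI : (0 : ℝ) ∈ Set.Icc (0 : ℝ) 1 := by simp
    have := key hI (S := ∅) (Or.inr rfl)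
    rw [expectedPayoff, integral_congr_ae (ae_of_all _ fun ω => by
      rw [hpayTop 0 ∅ ω (hnever 0 (Or.inl rfl) h0 ω)])] at this
    simpa [Player.sign, integral_outcome hB hI, affineValue] using this
  · have hI : (1 : ℝ) ∈ Set.Icc (0 : ℝ) 1 := by simp
    have := key hI (S := ∅) (Or.inr rfl)
    rw [expectedPayoff, integral_congr_ae (ae_of_all _ fun ω => by
      rw [hpayTop 1 ∅ ω (hnever 1 (Or.inr rfl) h1 ω)])] at this
    have h2 : (2 : ℝ) - 1 = 1 := by norm_num
    simpa [Player.sign, integral_outcome hB hI, affineValue, h2] using this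

end Unique

/-! ### Verification of the guarantees in the four cases. -/

lemma Player.option_cases (i : Player) (h : Option Player) :
    h = none ∨ h = some i ∨ h = some i.opp := by
  cases i <;> rcases h with _ | (_ | _) <;> simp [Player.opp]

section Values

variable (u w : ℝ) (i : Player) (k : ℕ) (h : Option Player)

lemma winValue_zero : winValue u w i 0 h = 1 := if_pos rfl

lemma winValue_succ_none : winValue u w i (k + 1) none = u * w := by simp [winValue]

lemma winValue_succ_self : winValue u w i (k + 1) (some i) = u := by
  simp [winValue, i.opp_ne.symm]

lemma winValue_succ_opp : winValue u w i (k + 1) (some i.opp) = w := by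
  simp [winValue, i.opp_ne]

lemma lossValue_zero : lossValue u w i 0 h = -1 := by rw [lossValue, winValue_zero]

lemma lossValue_succ_none : lossValue u w i (k + 1) none = -(u * w) := by
  rw [lossValue, winValue_succ_none]

lemma lossValue_succ_self : lossValue u w i (k + 1) (some i) = -w := by
  have := winValue_succ_opp u w i.opp k
  rw [Player.opp_opp] at this
  rw [lossValue, this]

lemma lossValue_succ_opp : lossValue u w i (k + 1) (some i.opp) = -u := by
  rw [lossValue, winValue_succ_self]

end Values

/-- Here `u = y` and `w = 1`: a certain winner doubles to enlarge the stake, and everyone accepts. A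
decline would yield `x ≥ y`, no less than the claimed value at `1`. With further doubles left,
accepting leaves the responder `y * (y - 1) * q ≥ 0` to spare if both could double, since the cube
is now the responder's. -/
lemma guarantees_double_at_one {x y : ℝ} (hxy : x ≥ y) (hy : y > 1) (i : Player) :
    Guarantees x y i {1} (fun _ _ => Set.univ) (winValue y 1 i) (lossValue y 1 i) where
  zero_win h := (winValue_zero ..).le
  zero_loss h := (lossValue_zero ..).le
  offer_accepted k h hh q hq := by
    obtain rfl : q = 1 := hq
    rcases i.option_cases h with rfl | rfl | rfl
    · cases k <;> simp only [affineValue, winValue_zero, winValue_succ_none, winValue_succ_opp] <;>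
        linarith
    · cases k <;> simp only [affineValue, winValue_zero, winValue_succ_self, winValue_succ_opp] <;>
        linarith
    · exact absurd rfl hh
  offer_declined k h hh q hq := by
    obtain rfl : q = 1 := hq
    rcases i.option_cases h with rfl | rfl | rfl
    · simp only [affineValue, winValue_succ_none]
      linarith
    · simp only [affineValue, winValue_succ_self]
      linarith
    · exact absurd rfl hh
  accept k h hh q hq _ := by
    have h0 := mul_nonneg hq.1 (sub_nonneg.2 hy.le)
    have h1 : 0 ≤ y * (q * (y - 1)) := mul_nonneg (by linarith) h0
    rcases i.option_cases h with rfl | rfl | rfl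
    · cases k <;> simp only [affineValue, winValue_zero, lossValue_zero, winValue_succ_none,
        lossValue_succ_none, winValue_succ_self, lossValue_succ_self] <;> nlinarith
    · exact absurd rfl hh
    · cases k <;> simp only [affineValue, winValue_zero, lossValue_zero, winValue_succ_opp,
        lossValue_succ_opp, winValue_succ_self, lossValue_succ_self] <;> nlinarith
  decline k h hh q hq hq' := absurd (Set.mem_univ q) hq'
  win k h hh := by
    rcases i.option_cases h with rfl | rfl | rfl
    · exact absurd rfl (hh (by simp))
    · exact absurd rfl (hh (by simp [i.opp_ne.symm]))
    · rw [winValue_succ_opp]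
  loss k h _ := by
    rcases i.option_cases h with rfl | rfl | rfl
    · rw [lossValue_succ_none]; linarith
    · rw [lossValue_succ_self]
    · rw [lossValue_succ_opp]; linarith

/-- Here `u = 1` and `w = y`: a certain loser doubles to shrink the stake, and everyone accepts. A
decline would even turn the loss into `x ≥ 0`. The surplus of an accepting responder, with both
rights and further doubles, is `y * (1 - y) * (1 - q)`. -/
lemma guarantees_double_at_zero {x y : ℝ} (hx : x ≥ 0) (hy0 : 0 < y) (hy : y ≤ 1) (i : Player) :
    Guarantees x y i {0} (fun _ _ => Set.univ) (winValue 1 y i) (lossValue 1 y i) where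
  zero_win h := (winValue_zero ..).le
  zero_loss h := (lossValue_zero ..).le
  offer_accepted k h hh q hq := by
    obtain rfl : q = 0 := hq
    rcases i.option_cases h with rfl | rfl | rfl
    · cases k <;> simp only [affineValue, lossValue_zero, lossValue_succ_none,
        lossValue_succ_opp] <;> linarith
    · cases k <;> simp only [affineValue, lossValue_zero, lossValue_succ_self,
        lossValue_succ_opp] <;> linarith
    · exact absurd rfl hh
  offer_declined k h hh q hq := by
    obtain rfl : q = 0 := hq
    rcases i.option_cases h with rfl | rfl | rfl
    · simp only [affineValue, lossValue_succ_none]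
      linarith
    · simp only [affineValue, lossValue_succ_self]
      linarith
    · exact absurd rfl hh
  accept k h hh q hq _ := by
    have h0 := mul_nonneg (sub_nonneg.2 hq.2) (sub_nonneg.2 hy)
    have h1 : 0 ≤ y * ((1 - q) * (1 - y)) := mul_nonneg hy0.le h0
    rcases i.option_cases h with rfl | rfl | rfl
    · cases k <;> simp only [affineValue, winValue_zero, lossValue_zero, winValue_succ_none,
        lossValue_succ_none, winValue_succ_self, lossValue_succ_self] <;> nlinarith
    · exact absurd rfl hh
    · cases k <;> simp only [affineValue, winValue_zero, lossValue_zero, winValue_succ_opp,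
        lossValue_succ_opp, winValue_succ_self, lossValue_succ_self] <;> nlinarith
  decline k h hh q hq hq' := absurd (Set.mem_univ q) hq'
  win k h _ := by
    rcases i.option_cases h with rfl | rfl | rfl
    · rw [winValue_succ_none]; linarith
    · rw [winValue_succ_self]
    · rw [winValue_succ_opp]; exact hy
  loss k h hh := by
    rcases i.option_cases h with rfl | rfl | rfl
    · exact absurd rfl (hh (by simp))
    · exact absurd rfl (hh (by simp [i.opp_ne.symm]))
    · rw [lossValue_succ_opp]

lemma winValue_one_one (i : Player) (k : ℕ) (h : Option Player) : winValue 1 1 i k h = 1 := by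
  simp [winValue]

lemma lossValue_one_one (i : Player) (k : ℕ) (h : Option Player) : lossValue 1 1 i k h = -1 := by
  rw [lossValue, winValue_one_one]

open scoped Classical in
-- Here `u = w = 1`, so the value is `2 * q - 1` throughout, and a responder can always secure it.
-- For `y > 1`, accepting from `1 / 2` upwards magnifies a nonnegative value, and declining below
-- gains `-x > 0`. Otherwise `-x > 1`, and declining beats any value.
lemma guarantees_never_double {x y : ℝ} (hx : x < 0) (hxy : -x > 1 ∨ y > 1) (i : Player) :
    Guarantees x y i ∅ (fun _ _ => if y > 1 then Set.Ici (1 / 2) else ∅)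
      (winValue 1 1 i) (lossValue 1 1 i) where
  zero_win h := (winValue_zero ..).le
  zero_loss h := (lossValue_zero ..).le
  offer_accepted k h hh q hq := absurd hq (Set.notMem_empty q)
  offer_declined k h hh q hq := absurd hq (Set.notMem_empty q)
  accept k h hh q hq hq' := by
    split_ifs at hq' with hy
    · have hq2 : 1 / 2 ≤ q := hq'
      simp only [affineValue, winValue_one_one, lossValue_one_one]
      nlinarith
    · exact absurd hq' (Set.notMem_empty q)
  decline k h hh q hq hq' := by
    simp only [affineValue, winValue_one_one, lossValue_one_one]
    split_ifs at hq' with hy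
    · have hq2 : q < 1 / 2 := not_le.1 hq'
      linarith
    · have := hxy.resolve_right hy
      linarith [hq.2]
  win k h _ := (winValue_one_one ..).le
  loss k h _ := (lossValue_one_one ..).le

/-- Here `u = 1` and `w = -x`: a certain loser offers a double in order to pay only `-x ≤ 1`, and
everyone declines. Acceptance would cost the loser only `y ≤ -x`. -/
lemma guarantees_double_at_zero_decline {x y : ℝ} (hx1 : -1 ≤ x) (hx : x ≤ 0) (hy : y ≤ -x)
    (i : Player) :
    Guarantees x y i {0} (fun _ _ => ∅) (winValue 1 (-x) i) (lossValue 1 (-x) i) where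
  zero_win h := (winValue_zero ..).le
  zero_loss h := (lossValue_zero ..).le
  offer_accepted k h hh q hq := by
    obtain rfl : q = 0 := hq
    rcases i.option_cases h with rfl | rfl | rfl
    · cases k <;> simp only [affineValue, lossValue_zero, lossValue_succ_none,
        lossValue_succ_opp] <;> linarith
    · cases k <;> simp only [affineValue, lossValue_zero, lossValue_succ_self,
        lossValue_succ_opp] <;> linarith
    · exact absurd rfl hh
  offer_declined k h hh q hq := by
    obtain rfl : q = 0 := hq
    rcases i.option_cases h with rfl | rfl | rfl
    · simp only [affineValue, lossValue_succ_none]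
      linarith
    · simp only [affineValue, lossValue_succ_self]
      linarith
    · exact absurd rfl hh
  accept k h hh q hq hq' := absurd hq' (Set.notMem_empty q)
  decline k h hh q hq _ := by
    have h0 := mul_nonneg (sub_nonneg.2 hq.2) (neg_nonneg.2 hx)
    rcases i.option_cases h with rfl | rfl | rfl
    · simp only [affineValue, winValue_succ_none, lossValue_succ_none]
      nlinarith
    · exact absurd rfl hh
    · simp only [affineValue, winValue_succ_opp, lossValue_succ_opp]
      nlinarith [hq.2]
  win k h _ := by
    rcases i.option_cases h with rfl | rfl | rfl
    · rw [winValue_succ_none]; linarith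
    · rw [winValue_succ_self]
    · rw [winValue_succ_opp]; linarith
  loss k h hh := by
    rcases i.option_cases h with rfl | rfl | rfl
    · exact absurd rfl (hh (by simp))
    · exact absurd rfl (hh (by simp [i.opp_ne.symm]))
    · rw [lossValue_succ_opp]

lemma lossValue_eq (u w : ℝ) (i : Player) (k : ℕ) (h : Option Player) :
    lossValue u w i k h = -winValue u w i.opp k h := rfl

lemma affineValue_one_self (u w q : ℝ) :
    affineValue (winValue u w .A 1 (some .A)) (lossValue u w .A 1 (some .A)) q =
      u * q - w * (1 - q) := by
  rw [winValue_succ_self u w .A 0, lossValue_succ_self u w .A 0, affineValue]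
  ring

/-- Optimality and the resulting constraints on all other optimal rules. -/
theorem isOptimalDoubling_and_constraints [IsProbabilityMeasure P] {x y : ℝ} (hy : 0 < y)
    (hB : IsBrownianMotion 𝓕 B P) {D : Set ℝ} (hD : D = ∅ ∨ D = {0} ∨ D = {1})
    {R : ℕ → Bool → Set ℝ} (hR : ∀ k c, MeasurableSet (R k c)) {u w : ℝ}
    (hG : ∀ i, Guarantees x y i D R (winValue u w i) (lossValue u w i)) :
    IsOptimalDoubling P 𝓕 B x y D ∧ ∀ D' : Set ℝ, IsOptimalDoubling P 𝓕 B x y D' →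
      (∀ q ∈ Set.Icc (0 : ℝ) 1, q ∈ D' →
        u * q - w * (1 - q) ≤ y * (2 * q - 1) ∧ u * q - w * (1 - q) ≤ x) ∧
      ((0 : ℝ) ∉ D' → 1 ≤ w) ∧ ((1 : ℝ) ∉ D' → u ≤ 1) := by
  refine ⟨isOptimalDoubling_of_guarantees hy hB hD hR (lossValue_eq u w) hG, fun D' hD' => ?_⟩
  have h := (hG .A).constraints hy hB hD hR hD'
  simp only [affineValue_one_self] at h
  rw [winValue_succ_self u w .A 0, lossValue_succ_self u w .A 0] at h
  exact ⟨h.1, fun h0 => neg_le_neg_iff.1 (h.2.1 h0), h.2.2⟩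

end DoublingGame

end

/-! ### The four cases: optimality, and exclusion of other doubling sets. -/

theorem theorem3p1 {Ω : Type*} {mΩ : MeasurableSpace Ω} (P : Measure Ω) [IsProbabilityMeasure P]
    (𝓕 : Filtration ℝ≥0 mΩ) (B : ℝ≥0 → Ω → ℝ) (hB : DoublingGame.IsBrownianMotion 𝓕 B P)
    (x y : ℝ) (hy : 0 < y) :
    (x ≥ y → y > 1 →
      DoublingGame.IsOptimalDoubling P 𝓕 B x y {1} ∧
      DoublingGame.OnlyOptimalDoubling P 𝓕 B x y {1}) ∧
    (x ≥ 0 → y ≤ 1 →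
      DoublingGame.IsOptimalDoubling P 𝓕 B x y {0} ∧
      (y < 1 → DoublingGame.OnlyOptimalDoubling P 𝓕 B x y {0})) ∧
    (x < 0 → (-x > 1 ∨ y > 1) →
      DoublingGame.IsOptimalDoubling P 𝓕 B x y ∅ ∧
      DoublingGame.OnlyOptimalDoubling P 𝓕 B x y ∅) ∧
    (-1 ≤ x → x ≤ 0 → y ≤ -x →
      DoublingGame.IsOptimalDoubling P 𝓕 B x y {0} ∧
      (-1 < x → DoublingGame.OnlyOptimalDoubling P 𝓕 B x y {0})) := by
  refine ⟨fun hxy hy1 => ?_, fun hx hy1 => ?_, fun hx hxy => ?_, fun hx1 hx hyx => ?_⟩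
  · obtain ⟨hopt, hcon⟩ := DoublingGame.isOptimalDoubling_and_constraints hy hB
      (Or.inr (Or.inr rfl)) (fun _ _ => MeasurableSet.univ)
      (DoublingGame.guarantees_double_at_one hxy hy1)
    refine ⟨hopt, fun D' _ hD'I hD' => Set.Subset.antisymm (fun q hq => ?_) ?_⟩
    · have h := ((hcon D' hD').1 q (hD'I hq) hq).1
      have : q ≤ 1 := (hD'I hq).2
      refine le_antisymm this (not_lt.1 fun hlt => ?_)
      -- The constraint against an accepting opponent reads `(y - 1) * (1 - q) ≤ 0`.
      nlinarith [mul_pos (sub_pos.2 hy1) (sub_pos.2 hlt)]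
    · rw [Set.singleton_subset_iff]
      by_contra h1
      linarith [(hcon D' hD').2.2 h1]
  · obtain ⟨hopt, hcon⟩ := DoublingGame.isOptimalDoubling_and_constraints hy hB
      (Or.inr (Or.inl rfl)) (fun _ _ => MeasurableSet.univ)
      (DoublingGame.guarantees_double_at_zero hx hy hy1)
    refine ⟨hopt, fun hy1 D' _ hD'I hD' => Set.Subset.antisymm (fun q hq => ?_) ?_⟩
    · have h := ((hcon D' hD').1 q (hD'I hq) hq).1
      have : 0 ≤ q := (hD'I hq).1
      refine le_antisymm (not_lt.1 fun hlt => ?_) this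
      -- The constraint against an accepting opponent reads `(1 - y) * q ≤ 0`.
      nlinarith [mul_pos (sub_pos.2 hy1) hlt]
    · rw [Set.singleton_subset_iff]
      by_contra h0
      linarith [(hcon D' hD').2.1 h0]
  · obtain ⟨hopt, hcon⟩ := DoublingGame.isOptimalDoubling_and_constraints hy hB
      (Or.inl rfl) (fun _ _ => by
        split_ifs
        · exact measurableSet_Ici
        · exact MeasurableSet.empty)
      (DoublingGame.guarantees_never_double hx hxy)
    refine ⟨hopt, fun D' _ hD'I hD' => Set.eq_empty_of_forall_notMem fun q hq => ?_⟩
    obtain ⟨h1, h2⟩ := (hcon D' hD').1 q (hD'I hq) hq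
    have h0 := (hD'I hq).1
    -- A declined double needs `2 * q - 1 ≤ x`, impossible if `x < -1`. As `x < 0`, it makes `2 * q
    -- - 1` negative, and then an accepted double with `y > 1` only magnifies the loss.
    rcases hxy with hx1 | hy1
    · linarith
    · nlinarith
  · obtain ⟨hopt, hcon⟩ := DoublingGame.isOptimalDoubling_and_constraints hy hB
      (Or.inr (Or.inl rfl)) (fun _ _ => MeasurableSet.empty)
      (DoublingGame.guarantees_double_at_zero_decline hx1 hx hyx)
    refine ⟨hopt, fun hx1 D' _ hD'I hD' => Set.Subset.antisymm (fun q hq => ?_) ?_⟩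
    · have h := ((hcon D' hD').1 q (hD'I hq) hq).2
      have : 0 ≤ q := (hD'I hq).1
      refine le_antisymm (not_lt.1 fun hlt => ?_) this
      -- The constraint against a declining opponent reads `q * (1 - x) ≤ 0`.
      nlinarith
    · rw [Set.singleton_subset_iff]
      by_contra h0
      linarith [(hcon D' hD').2.1 h0]
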